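/- Let $\Omega$ be a connected, paracompact (Hausdorff) complex analytic manifold of dimension $n\ge 1$ with basepoint $p$, and let $E$ be a complex Hilbert space with a conjugate linear isometric involution $f\mapsto f^\star$; put $f\cdot g=\langle f,g^\star\rangle_E$. For an $E$-valued analytic $n$-form $\alpha$ on $\Omega$, locally $\alpha=f\,dz_1\wedge\cdots\wedge dz_n$ with $f$ analytic, let $\alpha^\star=f^\star\,d\bar z_1\wedge\cdots\wedge d\bar z_n$ and $P_n=(-2i)^n(-1)^{n(n-1)/2}$. Then $\alpha\wedge\alpha^\star/P_n$ (values being multiplied by $f\cdot g$) is the volume measure equal to $\|f\|_E^2\,dx_1dy_1\cdots dx_ndy_n$ in local coordinates. Let $k:\Omega\to\mathbb R$ be an admissible weight: $k$ is Lebesgue measurable, and each $a\in\Omega$ has a connected open coordinate neighborhood on which $k>\varepsilon$ a.e. for some constant $\varepsilon>0$. Let $A^2(E,\Omega,k)$ be the space of all $E$-valued analytic $n$-forms $\alpha$ on $\Omega$ with $$\|\alpha\|^2=\int_\Omega k\,\alpha\wedge\alpha^\star/P_n<\infty .$$ Let $R=H^\infty(\Omega)$ be the algebra of bounded complex valued analytic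 functions on $\Omega$ or, when $\Omega$ is a bounded domain in $\mathbb C^n$, let $R$ be either $H^\infty(\Omega)$ or $\mathbb C[z_1,\dots,z_n]$ (as functions on $\Omega$). Let $\operatorname{ord}(r)$, for $r\in R$, be the order of the zero of $r$ at $p$, and $\operatorname{ord}(\alpha)$ the order of the zero at $p$ of the function $f$ that represents $\alpha$ in local coordinates ($\infty$ for $r=0$, $\alpha=0$). **Theorem.** $H=A^2(E,\Omega,k)$ is an analytic Hilbert module of $E$-valued analytic $n$-forms over $R$: it is a linear space of analytic $n$-forms, $\|\cdot\|$ is a Hilbert space norm on it, it is an $R$-module under pointwise multiplication, each multiplication map $\alpha\mapsto r\alpha$ is continuous, and norm convergence in $H$ implies uniform convergence on compact sets (of the coefficient functions, in all local coordinates). It is a valuation Hilbert module over the valuation algebra $R$, that is, for $r,s\in R$, $\alpha,\beta\in H$ and $0\ne\lambda\in\mathbb C$: * $\operatorname{ord}(r)=0$ if $r$ is invertible in $R$; $\operatorname{ord}(r)=\infty$ iff $r=0$; $\operatorname{ord}(rs)\ge\operatorname{ord}(r)+\operatorname{ord}(s)$; $\operatorname{ord}(\lambda r)=\operatorname{ord}(r)$;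 $\operatorname{ord}(r+s)\ge\min(\operatorname{ord}(r),\operatorname{ord}(s))$; * $\operatorname{ord}(\alpha)=\infty$ iff $\alpha=0$; $\operatorname{ord}(r\alpha)\ge\operatorname{ord}(r)+\operatorname{ord}(\alpha)$; $\operatorname{ord}(\lambda\alpha)=\operatorname{ord}(\alpha)$; $\operatorname{ord}(\alpha+\beta)\ge\min(\operatorname{ord}(\alpha),\operatorname{ord}(\beta))$; and $\operatorname{ord}$ is upper semicontinuous on $H$. Consequently the abstract Beurling theorem and its corollary apply to $H$. For a closed subspace $V\subseteq H$ put $V_m=\{h\in V:\operatorname{ord}(h)\ge m\}$ and $W_m=V_m\ominus V_{m+1}$ ($m=0,1,2,\dots$); let $P_m^H$ be the orthogonal projection of $H$ onto $H_m\ominus H_{m+1}$, and $R_1=\{r\in R:\operatorname{ord}(r)\ge1\}$. Then the following are equivalent: 1. $V$ is $R_1$-invariant; 2. $V$ is an $R$-submodule of $H$; 3. for all $j,m\ge0$, $r\in R_1$, $h\in W_j$, $g\in V$: if $\operatorname{ord}(rh+g)>m$ then $rh+g\perp W_m$ (the decomposition is near inner), and if $\operatorname{ord}(rh+g)\ge m$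 then $P_m^H(rh+g)\in P_m^H(W_m)$ (it has the full projection property). -/

import Mathlib

open Filter Topology MeasureTheory Manifold Set
open scoped ENNReal NNReal ContDiff InnerProductSpace TensorProduct Matrix

noncomputable section

/-! ### Valuation algebras and valuation Hilbert modules -/

section Abstract

/-- `ord` is an algebra valuation on the complex algebra `R`. -/
structure IsAlgebraValuation {R : Type*} [Ring R] [Algebra ℂ R] (ord : R → ℕ∞) : Prop where
  ord_unit : ∀ r : R, ((∃ s, s * r = 1) ∨ (∃ s, r * s = 1)) → ord r = 0
  ord_eq_top_iff : ∀ r : R, ord r = ⊤ ↔ r = 0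
  ord_mul : ∀ r s : R, ord r + ord s ≤ ord (r * s)
  ord_smul : ∀ (c : ℂ) (r : R), c ≠ 0 → ord (c • r) = ord r
  ord_add : ∀ r s : R, min (ord r) (ord s) ≤ ord (r + s)

/-- `H` is a left Hilbert module over the complex algebra `R`: a complex Hilbert space and a left
`R`-module such that every multiplication map `h ↦ r • h` is continuous. -/
structure IsHilbertModule (R H : Type*) [Ring R] [Algebra ℂ R] [NormedAddCommGroup H]
    [InnerProductSpace ℂ H] [Module R H] : Prop where
  complete : CompleteSpace H
  smul_assoc : ∀ (c : ℂ) (r : R) (h : H), (c • r) • h = c • (r • h)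
  continuous_smul : ∀ r : R, Continuous fun h : H => r • h

/-- `ord` is a Hilbert module valuation on `H` with respect to `(R, ordR)`. -/
structure IsHilbertModuleValuation {R H : Type*} [Ring R] [Algebra ℂ R] [NormedAddCommGroup H]
    [InnerProductSpace ℂ H] [Module R H] (ordR : R → ℕ∞) (ord : H → ℕ∞) : Prop where
  ord_eq_top_iff : ∀ h : H, ord h = ⊤ ↔ h = 0
  ord_action : ∀ (r : R) (h : H), ordR r + ord h ≤ ord (r • h)
  ord_smul : ∀ (c : ℂ) (h : H), c ≠ 0 → ord (c • h) = ord h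
  ord_add : ∀ h₁ h₂ : H, min (ord h₁) (ord h₂) ≤ ord (h₁ + h₂)
  upperSemicontinuous : UpperSemicontinuous ord

/-- `(H, ord)` is a valuation Hilbert module over the valuation algebra `(R, ordR)`. -/
structure IsValuationHilbertModule {R H : Type*} [Ring R] [Algebra ℂ R] [NormedAddCommGroup H]
    [InnerProductSpace ℂ H] [Module R H] (ordR : R → ℕ∞) (ord : H → ℕ∞) : Prop where
  algebraValuation : IsAlgebraValuation ordR
  hilbertModule : IsHilbertModule R H
  moduleValuation : IsHilbertModuleValuation ordR ord

namespace IsValuationHilbertModule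

variable {R H : Type*} [Ring R] [Algebra ℂ R] [NormedAddCommGroup H]
  [InnerProductSpace ℂ H] [Module R H] {ordR : R → ℕ∞} {ord : H → ℕ∞}

/-- The valuation subspace series `V_k = {h ∈ V : ord h ≥ k}` of a subspace `V`. -/
def valuationSubspace (hv : IsValuationHilbertModule ordR ord) (V : Submodule ℂ H) (k : ℕ) :
    Submodule ℂ H where
  carrier := {h | h ∈ V ∧ (k : ℕ∞) ≤ ord h}
  zero_mem' := ⟨V.zero_mem, by rw [(hv.moduleValuation.ord_eq_top_iff 0).2 rfl]; exact le_top⟩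
  add_mem' := fun {a b} ha hb =>
    ⟨V.add_mem ha.1 hb.1, (le_min ha.2 hb.2).trans (hv.moduleValuation.ord_add a b)⟩
  smul_mem' := fun c h hh => by
    refine ⟨V.smul_mem c hh.1, ?_⟩
    by_cases hc : c = 0
    · rw [hc, zero_smul, (hv.moduleValuation.ord_eq_top_iff 0).2 rfl]; exact le_top
    · rw [hv.moduleValuation.ord_smul c h hc]; exact hh.2

/-- The near homogeneous components `W_k = V_k ⊖ V_{k+1}` of a subspace `V`. -/
def component (hv : IsValuationHilbertModule ordR ord) (V : Submodule ℂ H) (k : ℕ) :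
    Submodule ℂ H :=
  hv.valuationSubspace V k ⊓ (hv.valuationSubspace V (k + 1))ᗮ

theorem isClosed_valuationSubspace_top (hv : IsValuationHilbertModule ordR ord) (k : ℕ) :
    IsClosed (hv.valuationSubspace ⊤ k : Set H) := by
  have h := hv.moduleValuation.upperSemicontinuous.isClosed_preimage (k : ℕ∞)
  convert h using 1
  ext x
  simp [valuationSubspace]

theorem hasOrthogonalProjection_component_top (hv : IsValuationHilbertModule ordR ord) (k : ℕ) :
    (hv.component ⊤ k).HasOrthogonalProjection := by
  have := hv.hilbertModule.complete
  have hc : IsClosed (hv.component ⊤ k : Set H) := by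
    have := (hv.isClosed_valuationSubspace_top k).inter
      (Submodule.isClosed_orthogonal (hv.valuationSubspace ⊤ (k + 1)))
    simpa [component] using this
  have : CompleteSpace (hv.component ⊤ k) := hc.completeSpace_coe
  infer_instance

/-- `P_m^H`: the orthogonal projection of `H` onto the `m`-th near homogeneous component of `H`
itself. -/
def projection (hv : IsValuationHilbertModule ordR ord) (m : ℕ) : H →L[ℂ] H :=
  haveI := hv.hasOrthogonalProjection_component_top m
  (hv.component ⊤ m).starProjection

/-- The near homogeneous decomposition of `V` is near inner. -/
def IsNearInner (hv : IsValuationHilbertModule ordR ord) (V : Submodule ℂ H) : Prop :=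
  ∀ k m : ℕ, ∀ h ∈ hv.component V k, ∀ g ∈ V, ∀ r : R, 1 ≤ ordR r →
    (m : ℕ∞) < ord (r • h + g) → r • h + g ∈ (hv.component V m)ᗮ

/-- The near homogeneous decomposition of `V` has the full projection property. -/
def HasFullProjection (hv : IsValuationHilbertModule ordR ord) (V : Submodule ℂ H) : Prop :=
  ∀ k m : ℕ, ∀ r : R, 1 ≤ ordR r → ∀ h ∈ hv.component V k, ∀ g ∈ V,
    (m : ℕ∞) ≤ ord (r • h + g) →
      hv.projection m (r • h + g) ∈ hv.projection m '' (hv.component V m : Set H)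

/-- The conclusion of the abstract Beurling theorem and of its corollary for the valuation Hilbert
module `(H, ord)`: among the closed subspaces `V` of `H`, those invariant under
`R₁ = {r : ord r ≥ 1}`, and likewise those that are `R`-submodules, are exactly the ones whose near
homogeneous decomposition is near inner and has the full projection property. -/
def BeurlingCharacterization (hv : IsValuationHilbertModule ordR ord) : Prop :=
  ∀ V : Submodule ℂ H, IsClosed (V : Set H) →
    ((∀ r : R, 1 ≤ ordR r → ∀ h ∈ V, r • h ∈ V) ↔ hv.IsNearInner V ∧ hv.HasFullProjection V) ∧
    ((∀ r : R, ∀ h ∈ V, r • h ∈ V) ↔ hv.IsNearInner V ∧ hv.HasFullProjection V)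

end IsValuationHilbertModule

end Abstract

/-! ### The wedge product `α ∧ α⋆` of vector-valued forms at a point -/

section Wedge

variable {n : ℕ} {E : Type*} [NormedAddCommGroup E] [InnerProductSpace ℂ E]

/-- A conjugate linear involution on `E`: a conjugate linear isometry of `E` onto `E` that is its
own inverse. -/
structure ConjInvolution (E : Type*) [NormedAddCommGroup E] [InnerProductSpace ℂ E] where
  toEquiv : E ≃ₗᵢ⋆[ℂ] E
  involutive : ∀ f, toEquiv (toEquiv f) = f

/-- The bilinear form `f · g = ⟨f, g⋆⟩` on `E` for an inner product `⟨·, ·⟩` that is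
linear in its first argument (Mathlib's is linear in the second one). -/
def ConjInvolution.dot (S : ConjInvolution E) : E →ₗ[ℝ] E →ₗ[ℝ] ℂ :=
  LinearMap.mk₂ ℝ (fun f g => inner ℂ (S.toEquiv g) f)
    (fun f₁ f₂ g => inner_add_right _ _ _)
    (fun c f g => by rw [← Complex.coe_smul, inner_smul_right]; simp)
    (fun f g₁ g₂ => by rw [map_add, inner_add_left])
    (fun c f g => by
      rw [← Complex.coe_smul, LinearIsometryEquiv.map_smulₛₗ, inner_smul_left]; simp)

/-- `α⋆` for an `E`-valued `n`-covector `α`, as a real alternating form. -/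
def ConjInvolution.starForm (S : ConjInvolution E) (a : (Fin n → ℂ) [⋀^Fin n]→L[ℂ] E) :
    (Fin n → ℂ) [⋀^Fin n]→ₗ[ℝ] E :=
  LinearMap.compAlternatingMap
    ({ toFun := S.toEquiv
       map_add' := map_add _
       map_smul' := fun c f => by
        rw [← Complex.coe_smul, LinearIsometryEquiv.map_smulₛₗ]; simp } : E →ₗ[ℝ] E)
    (a.restrictScalars ℝ).toAlternatingMap

/-- The complex-valued real `2n`-covector `α ∧ α⋆`, the values of `α` and `α⋆` being multiplied
by `f · g`. The slots `Sum.inl i` are the first `n` ones, the slots `Sum.inr i` the last `n`. -/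
def ConjInvolution.wedgeStar (S : ConjInvolution E) (a : (Fin n → ℂ) [⋀^Fin n]→L[ℂ] E) :
    (Fin n → ℂ) [⋀^Fin n ⊕ Fin n]→ₗ[ℝ] ℂ :=
  LinearMap.compAlternatingMap (TensorProduct.lift S.dot)
    ((a.restrictScalars ℝ).toAlternatingMap.domCoprod (S.starForm a))

/-- The coordinate frame `∂/∂x₁, ∂/∂y₁, …, ∂/∂xₙ, ∂/∂yₙ` of `ℂⁿ`, in this order. -/
def realFrame (n : ℕ) (s : Fin n ⊕ Fin n) : Fin n → ℂ := fun i =>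
  if (finSumFinEquiv s : ℕ) = 2 * i then 1
  else if (finSumFinEquiv s : ℕ) = 2 * i + 1 then Complex.I else 0

/-- The constant `Pₙ = (-2i)ⁿ (-1)^{n(n-1)/2}`. -/
def Pconst (n : ℕ) : ℂ := (-2 * Complex.I) ^ n * (-1) ^ (n * (n - 1) / 2)

/-- The coefficient of `α ∧ α⋆ / Pₙ` with respect to `dx₁ ∧ dy₁ ∧ ⋯ ∧ dxₙ ∧ dyₙ`. -/
def ConjInvolution.density (S : ConjInvolution E) (a : (Fin n → ℂ) [⋀^Fin n]→L[ℂ] E) : ℂ :=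
  S.wedgeStar a (realFrame n) / Pconst n

end Wedge

section WedgeLemmas
variable {n : ℕ} {E : Type*} [NormedAddCommGroup E] [InnerProductSpace ℂ E]

/-- The value of `dz_s` (for `s < n`), resp. of the conjugate of `dz_{s-n}` (for `s ≥ n`), on the
`j`-th vector of the real coordinate frame. -/
def frameEntry (n s j : ℕ) : ℂ :=
  if s < n then (if j = 2 * s then 1 else if j = 2 * s + 1 then Complex.I else 0)
  else (if j = 2 * (s - n) then 1 else if j = 2 * (s - n) + 1 then -Complex.I else 0)

theorem det_frame (n : ℕ) :
    (Matrix.of fun s j : Fin (2 * n) => frameEntry n s j).det = Pconst n := by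
  induction n with
  | zero => simp [Pconst]
  | succ n ih =>
    have hP : Pconst (n + 1) = (-2 * Complex.I) * (-1) ^ n * Pconst n := by
      have : (n + 1) * (n + 1 - 1) / 2 = n * (n - 1) / 2 + n := by
        rw [← Finset.sum_range_id_mul_two (n+1) |> fun h => (Nat.div_eq_of_eq_mul_left (by norm_num) h.symm).symm,
          ← Finset.sum_range_id_mul_two n |> fun h => (Nat.div_eq_of_eq_mul_left (by norm_num) h.symm).symm,
          Finset.sum_range_succ]
      rw [Pconst, Pconst, this]; ring
    have hsub : ∀ c : Fin 2, ((Matrix.of fun s j : Fin (2 * n + 1 + 1) =>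
        frameEntry (n + 1) s j).submatrix Fin.succ (Fin.succAbove (c.castLE (by omega)))).det =
        (-1) ^ n * (if c = 0 then -Complex.I else 1) * Pconst n := by
      intro c
      have hval : ((Fin.succAbove (c.castLE (by omega : 2 ≤ 2 * n + 1 + 1)) 0 : Fin _) : ℕ) =
          if c = 0 then 1 else 0 := by
        fin_cases c
        · simp [Fin.succAbove]
        · rw [Fin.succAbove_of_castSucc_lt _ _ (by simp [Fin.lt_def])]; simp
      rw [Matrix.det_succ_column_zero, Finset.sum_eq_single (⟨n, by omega⟩ : Fin (2 * n + 1))]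
      · rw [← ih]
        congr 1
        · simp only [Matrix.submatrix_apply, Matrix.of_apply, hval]
          fin_cases c <;> simp [frameEntry]
        · congr 1
          ext s j
          have hj : ((Fin.succAbove (c.castLE (by omega : 2 ≤ 2 * n + 1 + 1)) j.succ : Fin _) : ℕ)
              = j + 2 := by
            fin_cases c <;> simp [Fin.succAbove, Fin.lt_def]
          simp only [Matrix.submatrix_apply, Matrix.of_apply, hj]
          by_cases hs : (s : ℕ) < n
          · have : (Fin.succAbove (⟨n, by omega⟩ : Fin (2 * n + 1)) s : ℕ) = s := by
              simp [Fin.succAbove, Fin.lt_def, hs]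
            simp only [Fin.val_succ, this, frameEntry, hs, if_true, Nat.add_lt_add_iff_right]
            congr 1
            · simp; omega
            · congr 1; simp; omega
          · have : (Fin.succAbove (⟨n, by omega⟩ : Fin (2 * n + 1)) s : ℕ) = s + 1 := by
              simp [Fin.succAbove, Fin.lt_def, hs]
            have h2 : ¬ ((s : ℕ) + 1 + 1 < n + 1) := by omega
            simp only [Fin.val_succ, this, frameEntry, hs, if_false, h2]
            congr 1
            · simp; omega
            · congr 1; simp; omega
      · intro b _ hb
        have hb' : (b : ℕ) ≠ n := fun h => hb (Fin.ext h)
        have : ((Fin.succAbove (c.castLE (by omega : 2 ≤ 2 * n + 1 + 1)) 0 : Fin _) : ℕ) ≤ 1 := by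
          rw [hval]; split_ifs <;> decide
        have h0 : frameEntry (n + 1) (b + 1)
            (Fin.succAbove (c.castLE (by omega : 2 ≤ 2 * n + 1 + 1)) 0 : Fin _) = 0 := by
          unfold frameEntry
          split_ifs <;> first | rfl | omega
        simp [h0]
      · simp
    have h0 := hsub 0
    have h1 := hsub 1
    rw [show (Matrix.of fun s j : Fin (2 * (n + 1)) => frameEntry (n + 1) s j) =
      (Matrix.of fun s j : Fin (2 * n + 1 + 1) => frameEntry (n + 1) s j) from rfl,
      Matrix.det_succ_row_zero, Fin.sum_univ_succ, Fin.sum_univ_succ, Finset.sum_eq_zero, hP]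
    · have e0 : (Fin.castLE (by omega : 2 ≤ 2 * n + 1 + 1) 0) = 0 := rfl
      have e1 : (Fin.castLE (by omega : 2 ≤ 2 * n + 1 + 1) 1) = Fin.succ 0 := rfl
      rw [e0] at h0
      rw [e1] at h1
      rw [h0, h1]
      simp [frameEntry]
      ring
    · intro j _
      simp [frameEntry]

/-- Every `n`-covector on `ℂⁿ` is a multiple of `dz₁ ∧ ⋯ ∧ dzₙ`. -/
theorem covector_apply (a : (Fin n → ℂ) [⋀^Fin n]→L[ℂ] E) (v : Fin n → Fin n → ℂ) :
    a v = (Matrix.of v).det • a (fun i => Pi.single i 1) := by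
  have : a.toAlternatingMap = LinearMap.compAlternatingMap
      (LinearMap.toSpanSingleton ℂ E (a (fun i => Pi.single i 1)))
      (Pi.basisFun ℂ (Fin n)).det := by
    refine (Pi.basisFun ℂ (Fin n)).ext_alternating fun w hw => ?_
    let σ : Equiv.Perm (Fin n) := Equiv.ofBijective w (Finite.injective_iff_bijective.1 hw)
    have e : (fun i => (Pi.basisFun ℂ (Fin n)) (w i)) = (Pi.basisFun ℂ (Fin n)) ∘ σ := rfl
    rw [e, AlternatingMap.map_perm, AlternatingMap.map_perm]
    congr 1
    simp only [LinearMap.compAlternatingMap_apply, Module.Basis.det_self]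
    simp only [LinearMap.toSpanSingleton_apply, one_smul]
    change a _ = a _
    congr 1
    funext i
    simp
  have h2 := congrArg (fun f => f v) this
  simp only [LinearMap.compAlternatingMap_apply] at h2
  rw [Pi.basisFun_det] at h2
  exact h2

/-- In coordinates, `α ∧ α⋆ / Pₙ = ‖f‖² dx₁ ∧ dy₁ ∧ ⋯ ∧ dxₙ ∧ dyₙ` for `α = f dz₁ ∧ ⋯ ∧ dzₙ`. -/
theorem ConjInvolution.density_eq (S : ConjInvolution E) (a : (Fin n → ℂ) [⋀^Fin n]→L[ℂ] E) :
    S.density a = ((‖a fun i => Pi.single i 1‖ ^ 2 : ℝ) : ℂ) := by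
  set f := a fun i => Pi.single i 1 with hf
  let m1 : MultilinearMap ℝ (fun _ : Fin n => Fin n → ℂ) E :=
    ((LinearMap.toSpanSingleton ℂ E f).restrictScalars ℝ).compMultilinearMap
      ((MultilinearMap.mkPiAlgebra ℝ (Fin n) ℂ).compLinearMap fun i => LinearMap.proj i)
  let m2 : MultilinearMap ℝ (fun _ : Fin n => Fin n → ℂ) E :=
    ((LinearMap.toSpanSingleton ℂ E (S.toEquiv f)).restrictScalars ℝ).compMultilinearMap
      ((MultilinearMap.mkPiAlgebra ℝ (Fin n) ℂ).compLinearMap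
        fun i => Complex.conjAe.toLinearMap ∘ₗ LinearMap.proj i)
  have h1 : (a.restrictScalars ℝ).toAlternatingMap = MultilinearMap.alternatization m1 := by
    ext v
    rw [MultilinearMap.alternatization_apply]
    change a v = _
    rw [covector_apply, ← hf, Matrix.det_apply, Finset.sum_smul]
    refine Finset.sum_congr rfl fun σ _ => ?_
    rw [smul_assoc]
    rfl
  have h2 : S.starForm a = MultilinearMap.alternatization m2 := by
    ext v
    rw [MultilinearMap.alternatization_apply]
    change S.toEquiv (a v) = _
    rw [covector_apply, ← hf, LinearIsometryEquiv.map_smulₛₗ, Matrix.det_apply, map_sum,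
      Finset.sum_smul]
    refine Finset.sum_congr rfl fun σ _ => ?_
    rw [Units.smul_def, Units.smul_def, map_zsmul, smul_assoc, map_prod]
    rfl
  have h3 : S.wedgeStar a (realFrame n) = (‖f‖ ^ 2 : ℝ) * Pconst n := by
    rw [wedgeStar, h1, h2, ← MultilinearMap.domCoprod_alternization,
      LinearMap.compAlternatingMap_apply, MultilinearMap.alternatization_apply, map_sum,
      ← det_frame]
    have hc : n + n = 2 * n := by omega
    rw [← Matrix.det_submatrix_equiv_self (finSumFinEquiv.trans (finCongr hc)),
      ← Matrix.det_transpose, Matrix.det_apply, Finset.mul_sum]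
    refine Finset.sum_congr rfl fun σ _ => ?_
    rw [Units.smul_def, Units.smul_def, map_zsmul, mul_smul_comm]
    congr 1
    rw [MultilinearMap.domDomCongr_apply, MultilinearMap.domCoprod_apply, TensorProduct.lift.tmul,
      Fintype.prod_sum_type]
    have e1 : m1 (fun i => realFrame n (σ (Sum.inl i))) =
        (∏ i : Fin n, realFrame n (σ (Sum.inl i)) i) • f := rfl
    have e2 : m2 (fun i => realFrame n (σ (Sum.inr i))) =
        (∏ i : Fin n, (starRingEnd ℂ) (realFrame n (σ (Sum.inr i)) i)) • S.toEquiv f := rfl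
    rw [e1, e2]
    change inner ℂ (S.toEquiv _) _ = _
    rw [LinearIsometryEquiv.map_smulₛₗ, S.involutive, inner_smul_left, inner_smul_right,
      inner_self_eq_norm_sq_to_K, Complex.conj_conj]
    have p1 : ∀ i : Fin n, ∀ s, (Matrix.of fun s j : Fin (2 * n) => frameEntry n s j)
        (finSumFinEquiv.trans (finCongr hc) (Sum.inl i)) (finSumFinEquiv.trans (finCongr hc) s) =
        realFrame n s i := by
      intro i s
      simp [frameEntry, realFrame]
    have p2 : ∀ i : Fin n, ∀ s, (Matrix.of fun s j : Fin (2 * n) => frameEntry n s j)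
        (finSumFinEquiv.trans (finCongr hc) (Sum.inr i)) (finSumFinEquiv.trans (finCongr hc) s) =
        (starRingEnd ℂ) (realFrame n s i) := by
      intro i s
      simp only [frameEntry, realFrame, apply_ite (starRingEnd ℂ)]
      simp
    simp only [Matrix.transpose_apply, Matrix.submatrix_apply, p1, p2]
    push_cast
    ring_nf
    rfl
  have hP : Pconst n ≠ 0 := by simp [Pconst]
  rw [density, h3, mul_div_cancel_right₀ _ hP]

end WedgeLemmas

/-! ### Analytic functions and analytic `n`-forms on an `n`-dimensional complex manifold -/

section Manifold

variable (n : ℕ) (Ω : Type*) [TopologicalSpace Ω] [ChartedSpace (Fin n → ℂ) Ω]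

/-- `E`-valued differential forms of type `(n, 0)` on `Ω`, as families of `ℂ`-multilinear
alternating maps on the tangent spaces (no regularity imposed). -/
abbrev FormField (E : Type*) [NormedAddCommGroup E] [InnerProductSpace ℂ E] : Type _ :=
  ∀ x : Ω, TangentSpace 𝓘(ℂ, Fin n → ℂ) x [⋀^Fin n]→L[ℂ] E

/-- The algebra `H^∞(Ω)` of bounded complex valued analytic functions on `Ω`. -/
def boundedAnalytic : Subalgebra ℂ (Ω → ℂ) where
  carrier := {f | ContMDiff 𝓘(ℂ, Fin n → ℂ) 𝓘(ℂ, ℂ) ω f ∧ ∃ C : ℝ, ∀ x, ‖f x‖ ≤ C}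
  mul_mem' := by
    rintro f g ⟨hf, C, hC⟩ ⟨hg, D, hD⟩
    refine ⟨hf.mul hg, C * D, fun x => ?_⟩
    rw [Pi.mul_apply, norm_mul]
    exact mul_le_mul (hC x) (hD x) (norm_nonneg _) ((norm_nonneg _).trans (hC x))
  add_mem' := by
    rintro f g ⟨hf, C, hC⟩ ⟨hg, D, hD⟩
    exact ⟨hf.add hg, C + D, fun x => (norm_add_le _ _).trans (add_le_add (hC x) (hD x))⟩
  algebraMap_mem' := fun c => ⟨contMDiff_const, ‖c‖, fun _ => le_rfl⟩

/-- The algebra of polynomials `ℂ[z₁, …, zₙ]`, as functions on the open set `U ⊆ ℂⁿ`. -/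
def polynomialAlgebraOn {n : ℕ} (U : TopologicalSpace.Opens (Fin n → ℂ)) : Subalgebra ℂ (U → ℂ) :=
  (MvPolynomial.aeval fun (i : Fin n) (z : U) => (z : Fin n → ℂ) i :
    MvPolynomial (Fin n) ℂ →ₐ[ℂ] (U → ℂ)).range

/-- The order of the zero at `z` of a function `f` analytic near `z`: the least `m` such that some
partial derivative of order `m` does not vanish at `z`. -/
def orderOfZero {n : ℕ} {F : Type*} [NormedAddCommGroup F] [NormedSpace ℂ F]
    (f : (Fin n → ℂ) → F) (z : Fin n → ℂ) : ℕ∞ :=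
  ⨅ m ∈ {m : ℕ | iteratedFDeriv ℂ m f z ≠ 0}, (m : ℕ∞)

variable {n Ω} {E : Type*} [NormedAddCommGroup E] [InnerProductSpace ℂ E]

/-- The expression `f dz₁ ∧ ⋯ ∧ dzₙ` of the form `α` in the local coordinates `e`, as a field of
covectors on the open set `e.target` of `ℂⁿ`. -/
def inChart (e : OpenPartialHomeomorph Ω (Fin n → ℂ)) (α : FormField n Ω E) (z : Fin n → ℂ) :
    (Fin n → ℂ) [⋀^Fin n]→L[ℂ] E :=
  (α (e.symm z)).compContinuousLinearMap
    (mfderiv 𝓘(ℂ, Fin n → ℂ) 𝓘(ℂ, Fin n → ℂ) e.symm z)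

/-- The function `f` in the expression `α = f dz₁ ∧ ⋯ ∧ dzₙ` in the local coordinates `e`. -/
def chartCoeff (e : OpenPartialHomeomorph Ω (Fin n → ℂ)) (α : FormField n Ω E) (z : Fin n → ℂ) :
    E :=
  inChart e α z fun i => Pi.single i 1

/-- `α` is an analytic differential `n`-form: in all local coordinates
`α = f dz₁ ∧ ⋯ ∧ dzₙ` with `f` analytic. -/
def IsAnalyticForm (α : FormField n Ω E) : Prop :=
  ∀ e ∈ IsManifold.maximalAtlas 𝓘(ℂ, Fin n → ℂ) ω Ω, AnalyticOnNhd ℂ (chartCoeff e α) e.target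

/-- The order of the zero of the function `r` at the point `p`. -/
def functionOrder (p : Ω) (r : Ω → ℂ) : ℕ∞ :=
  orderOfZero (r ∘ (chartAt (Fin n → ℂ) p).symm) (chartAt (Fin n → ℂ) p p)

/-- The order of the zero of the form `α` at the point `p`. -/
def formOrder (p : Ω) (α : FormField n Ω E) : ℕ∞ :=
  orderOfZero (chartCoeff (chartAt (Fin n → ℂ) p) α) (chartAt (Fin n → ℂ) p p)

/-- `k` is an admissible weight function: it is Lebesgue measurable and each point has a connected
open coordinate neighbourhood on which `k` is a.e. bounded below by a positive constant. -/
structure IsAdmissibleWeight (n : ℕ) {Ω : Type*} [TopologicalSpace Ω] [ChartedSpace (Fin n → ℂ) Ω]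
    (k : Ω → ℝ) : Prop where
  measurable : ∀ e ∈ IsManifold.maximalAtlas 𝓘(ℂ, Fin n → ℂ) ω Ω,
    AEMeasurable (k ∘ e.symm) (volume.restrict e.target)
  bounded_below : ∀ a : Ω, ∃ e ∈ IsManifold.maximalAtlas 𝓘(ℂ, Fin n → ℂ) ω Ω,
    a ∈ e.source ∧ IsConnected e.source ∧
      ∃ ε : ℝ, 0 < ε ∧ ∀ᵐ z ∂(volume.restrict e.target), ε < k (e.symm z)

theorem chartCoeff_add (e : OpenPartialHomeomorph Ω (Fin n → ℂ)) (α β : FormField n Ω E) :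
    chartCoeff e (α + β) = chartCoeff e α + chartCoeff e β := rfl

theorem chartCoeff_smul (e : OpenPartialHomeomorph Ω (Fin n → ℂ)) (c : ℂ) (α : FormField n Ω E) :
    chartCoeff e (c • α) = c • chartCoeff e α := rfl

variable [MeasurableSpace Ω]

/-- The measure on the domain of the local coordinates `e` with density the coefficient of
`α ∧ α⋆ / Pₙ` with respect to `dx₁ dy₁ ⋯ dxₙ dyₙ`, extended by `0` to `Ω`. -/
def chartMeasure (S : ConjInvolution E) (α : FormField n Ω E)
    (e : OpenPartialHomeomorph Ω (Fin n → ℂ)) : Measure Ω :=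
  ((volume.restrict e.target).withDensity fun z =>
    ENNReal.ofReal (S.density (inChart e α z)).re).map e.symm

/-- The volume measure `α ∧ α⋆ / Pₙ` on `Ω`, glued from its restrictions to the coordinate domains:
since these restrictions agree on overlaps, the glued measure is their least upper bound. -/
def formMeasure (S : ConjInvolution E) (α : FormField n Ω E) : Measure Ω :=
  ⨆ e ∈ IsManifold.maximalAtlas 𝓘(ℂ, Fin n → ℂ) ω Ω, chartMeasure S α e

/-- `∫_Ω k α ∧ α⋆ / Pₙ`, with values in `[0, ∞]`. -/
def weightedNormSq (S : ConjInvolution E) (k : Ω → ℝ) (α : FormField n Ω E) : ℝ≥0∞ :=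
  ∫⁻ x, ENNReal.ofReal (k x) ∂(formMeasure S α)

theorem formMeasure_le [BorelSpace Ω] (S : ConjInvolution E) {α β γ : FormField n Ω E} (hα : IsAnalyticForm α)
    (C : ℝ≥0)
    (h : ∀ e z, ‖chartCoeff e γ z‖ ^ 2 ≤ C * (‖chartCoeff e α z‖ ^ 2 + ‖chartCoeff e β z‖ ^ 2)) :
    formMeasure S γ ≤ (C : ℝ≥0∞) • (formMeasure S α + formMeasure S β) := by
  have hd : ∀ (e : OpenPartialHomeomorph Ω (Fin n → ℂ)) (δ : FormField n Ω E) z,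
      ENNReal.ofReal (S.density (inChart e δ z)).re = ENNReal.ofReal (‖chartCoeff e δ z‖ ^ 2) :=
    fun e δ z => by rw [S.density_eq, Complex.ofReal_re]; rfl
  have hle : ∀ e ∈ IsManifold.maximalAtlas 𝓘(ℂ, Fin n → ℂ) ω Ω, chartMeasure S γ e ≤
      (C : ℝ≥0∞) • (chartMeasure S α e + chartMeasure S β e) := by
    intro e he
    have hs : AEMeasurable e.symm (volume.restrict e.target) :=
      e.continuousOn_symm.aemeasurable e.open_target.measurableSet
    have hm : ∀ δ : FormField n Ω E, AEMeasurable e.symm ((volume.restrict e.target).withDensity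
        fun z => ENNReal.ofReal (S.density (inChart e δ z)).re) := fun δ =>
      hs.mono_ac (withDensity_absolutelyContinuous _ _)
    have hα' : AEMeasurable (fun z => ENNReal.ofReal (‖chartCoeff e α z‖ ^ 2))
        (volume.restrict e.target) := by
      refine ContinuousOn.aemeasurable ?_ e.open_target.measurableSet
      exact ENNReal.continuous_ofReal.comp_continuousOn ((hα e he).continuousOn.norm.pow 2)
    refine Measure.le_iff.2 fun s hs => ?_
    rw [Measure.smul_apply, Measure.add_apply, chartMeasure, chartMeasure, chartMeasure,
      Measure.map_apply_of_aemeasurable (hm γ) hs, Measure.map_apply_of_aemeasurable (hm α) hs,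
      Measure.map_apply_of_aemeasurable (hm β) hs, withDensity_apply' , withDensity_apply',
      withDensity_apply', smul_eq_mul]
    simp only [hd]
    rw [← lintegral_add_left' hα'.restrict, ← lintegral_const_mul' _ _ ENNReal.coe_ne_top]
    refine lintegral_mono fun z => ?_
    rw [← ENNReal.ofReal_add (by positivity) (by positivity), ← ENNReal.ofReal_coe_nnreal,
      ← ENNReal.ofReal_mul (NNReal.coe_nonneg C)]
    exact ENNReal.ofReal_le_ofReal (h e z)
  refine iSup₂_le fun e he => (hle e he).trans ?_
  have h1 : ∀ δ : FormField n Ω E, chartMeasure S δ e ≤ formMeasure S δ := fun δ =>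
    le_iSup₂ (f := fun e (_ : e ∈ IsManifold.maximalAtlas 𝓘(ℂ, Fin n → ℂ) ω Ω) =>
      chartMeasure S δ e) e he
  refine Measure.le_iff.2 fun s _ => ?_
  simp only [Measure.smul_apply, Measure.add_apply, smul_eq_mul]
  exact mul_le_mul_right (add_le_add (h1 α s) (h1 β s)) _

/-- The `E`-valued weighted Bergman space `A²(E, Ω, k)` of differentials. -/
def bergmanSpace [BorelSpace Ω] (S : ConjInvolution E) (k : Ω → ℝ) : Submodule ℂ (FormField n Ω E) where
  carrier := {α | IsAnalyticForm α ∧ weightedNormSq S k α < ⊤}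
  zero_mem' := by
    refine ⟨fun e _ => ?_, ?_⟩
    · have : chartCoeff e (0 : FormField n Ω E) = 0 := rfl
      rw [this]
      exact analyticOnNhd_const
    · have h0 : formMeasure S (0 : FormField n Ω E) = 0 := by
        have hz : ∀ (e : OpenPartialHomeomorph Ω (Fin n → ℂ)) z,
            S.density (inChart e (0 : FormField n Ω E) z) = 0 := fun e z => by
          rw [S.density_eq]
          change ((‖(0 : E)‖ ^ 2 : ℝ) : ℂ) = 0
          simp
        refine le_antisymm (iSup₂_le fun e _ => ?_) (Measure.zero_le _)
        simp [chartMeasure, hz]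
      simp [weightedNormSq, h0]
  add_mem' := by
    rintro α β ⟨hα, fα⟩ ⟨hβ, fβ⟩
    refine ⟨fun e he => (hα e he).add (hβ e he), ?_⟩
    have := formMeasure_le S (γ := α + β) (β := β) hα 2 fun e z => by
      rw [chartCoeff_add, Pi.add_apply]
      have := norm_add_le (chartCoeff e α z) (chartCoeff e β z)
      have h2 := norm_nonneg (chartCoeff e α z + chartCoeff e β z)
      push_cast
      nlinarith [sq_nonneg (‖chartCoeff e α z‖ - ‖chartCoeff e β z‖)]
    refine (lintegral_mono' this le_rfl).trans_lt ?_
    rw [lintegral_smul_measure, lintegral_add_measure]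
    exact ENNReal.mul_lt_top ENNReal.coe_lt_top (ENNReal.add_lt_top.2 ⟨fα, fβ⟩)
  smul_mem' := by
    rintro c α ⟨hα, fα⟩
    refine ⟨fun e he => (hα e he).const_smul, ?_⟩
    have := formMeasure_le S (γ := c • α) (β := α) hα (‖c‖₊ ^ 2) fun e z => by
      rw [chartCoeff_smul, Pi.smul_apply, norm_smul, mul_pow]
      push_cast
      have := mul_nonneg (sq_nonneg ‖c‖) (sq_nonneg ‖chartCoeff e α z‖)
      linarith
    refine (lintegral_mono' this le_rfl).trans_lt ?_
    rw [lintegral_smul_measure, lintegral_add_measure]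
    exact ENNReal.mul_lt_top ENNReal.coe_lt_top (ENNReal.add_lt_top.2 ⟨fα, fα⟩)

/-- `H`, whose elements are identified with forms through `ι`, is an analytic Hilbert module of
`E`-valued analytic `n`-forms on `Ω` over the algebra `R` of analytic functions on `Ω`. -/
structure IsAnalyticHilbertModuleOfForms (R : Subalgebra ℂ (Ω → ℂ)) {H : Type*}
    [NormedAddCommGroup H] [InnerProductSpace ℂ H] [Module R H] (ι : H →ₗ[ℂ] FormField n Ω E) :
    Prop where
  analytic_algebra : ∀ r ∈ R, ContMDiff 𝓘(ℂ, Fin n → ℂ) 𝓘(ℂ, ℂ) ω r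
  injective : Function.Injective ι
  analytic_form : ∀ h : H, IsAnalyticForm (ι h)
  hilbertModule : IsHilbertModule R H
  pointwise : ∀ (r : R) (h : H) (x : Ω), ι (r • h) x = (r : Ω → ℂ) x • ι h x
  /-- Norm convergence implies uniform convergence on compact sets, the latter being understood
  for the functions that represent the forms in local coordinates. -/
  uniform_on_compacts : ∀ (h : ℕ → H) (h₀ : H), Tendsto h atTop (𝓝 h₀) →
    ∀ e ∈ IsManifold.maximalAtlas 𝓘(ℂ, Fin n → ℂ) ω Ω, ∀ K ⊆ e.target, IsCompact K →
      TendstoUniformlyOn (fun j => chartCoeff e (ι (h j))) (chartCoeff e (ι h₀)) atTop K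

/-- There are a (necessarily unique) inner product on `A²(E, Ω, k)` with
`‖α‖² = ∫_Ω k α ∧ α⋆ / Pₙ` and a (necessarily unique) pointwise `R`-module structure that make
`A²(E, Ω, k)` an analytic Hilbert module of `n`-forms over `R` and, with the orders of the zeros at
`p`, a valuation Hilbert module over `R`, whose closed invariant subspaces are characterized as in
the abstract Beurling theorem and its corollary. -/
def BergmanSpaceIsBeurlingModule [BorelSpace Ω] (S : ConjInvolution E) (k : Ω → ℝ) (p : Ω)
    (R : Subalgebra ℂ (Ω → ℂ)) : Prop :=
  ∃ (c : InnerProductSpace.Core ℂ (bergmanSpace (n := n) S k))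
    (_M : Module R (bergmanSpace (n := n) S k)),
    letI : NormedAddCommGroup (bergmanSpace (n := n) S k) := c.toNormedAddCommGroup
    letI : InnerProductSpace ℂ (bergmanSpace (n := n) S k) := .ofCore c.toCore
    (∀ α : bergmanSpace (n := n) S k,
      ‖α‖ ^ 2 = (weightedNormSq S k (α : FormField n Ω E)).toReal) ∧
    IsAnalyticHilbertModuleOfForms R (bergmanSpace (n := n) S k).subtype ∧
    ∃ hv : IsValuationHilbertModule (fun r : R => functionOrder (n := n) p (r : Ω → ℂ))
        (fun α : bergmanSpace (n := n) S k => formOrder p (α : FormField n Ω E)),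
      hv.BeurlingCharacterization

end Manifold

end

/-! Abstract part. The subspaces H_m = {ord ≥ m} are closed, by upper semicontinuity, and intersect
in 0. Hence the components W_m of a closed V span a dense subspace of V (`le_of_component_le`), and
on H_m the projection P_m^H has kernel H_{m+1}: it plays the role of the leading term. If V is
R₁-invariant, then rh + g lies in V, and both properties in the theorem follow from V_m = W_m +
V_{m+1}.

Conversely, let h ∈ W_j and let x = rh + g be the component of rh orthogonal to V. Suppose that x
has finite order m. The full projection property gives w ∈ W_m with the same leading term, so x - w
has order > m, and near innerness makes x - w orthogonal to w. But x ⟂ w as well, so w = 0 and ord x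
> m, a contradiction. Thus rW_j ⊆ V for all j, and rV ⊆ V by density and continuity
(`invariant_of_isNearInner`). Since r - r(p) ∈ R₁, invariance under R₁ is the same as invariance
under R.

Analytic part. The mean value inequality for ‖f‖² on polydiscs and the local lower bounds of k show
that the norm controls the coefficients locally uniformly (`exists_enorm_sq_chartCoeff_le`).
Cauchy's estimates then make every derivative at p continuous in the form, whence the upper
semicontinuity of ord; Weierstrass' theorem makes limits of Cauchy sequences analytic. The volume
measures of different charts agree on overlaps, because the real Jacobian is the squared modulus of
the complex one. A connected paracompact manifold has a countable measurable partition into pieces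
of chart domains, which embeds A² isometrically in an L² space. The image is closed, and this gives
both the inner product and completeness. The order axioms reduce to the identity theorem and
Leibniz' formula. -/

/-! ### The abstract Beurling theorem -/

namespace IsValuationHilbertModule

variable {R H : Type*} [Ring R] [Algebra ℂ R] [NormedAddCommGroup H]
  [InnerProductSpace ℂ H] [Module R H] {ordR : R → ℕ∞} {ord : H → ℕ∞}

theorem mem_valuationSubspace (hv : IsValuationHilbertModule ordR ord) {V : Submodule ℂ H} {k : ℕ}
    {h : H} : h ∈ hv.valuationSubspace V k ↔ h ∈ V ∧ (k : ℕ∞) ≤ ord h := Iff.rfl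

theorem isClosed_valuationSubspace (hv : IsValuationHilbertModule ordR ord) {V : Submodule ℂ H}
    (hV : IsClosed (V : Set H)) (k : ℕ) : IsClosed (hv.valuationSubspace V k : Set H) := by
  have : (hv.valuationSubspace V k : Set H) = (V : Set H) ∩ (hv.valuationSubspace ⊤ k : Set H) := by
    ext x
    simp [valuationSubspace]
  rw [this]
  exact hV.inter (hv.isClosed_valuationSubspace_top k)

/-- `V_k = W_k + V_{k+1}` for a closed subspace `V`. -/
theorem exists_component_add (hv : IsValuationHilbertModule ordR ord) {V : Submodule ℂ H}
    (hV : IsClosed (V : Set H)) {k : ℕ} {x : H} (hx : x ∈ hv.valuationSubspace V k) :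
    ∃ w ∈ hv.component V k, ∃ v ∈ hv.valuationSubspace V (k + 1), x = w + v := by
  have := hv.hilbertModule.complete
  have : CompleteSpace (hv.valuationSubspace V (k + 1)) :=
    (hv.isClosed_valuationSubspace hV (k + 1)).completeSpace_coe
  have hv1 := (hv.valuationSubspace V (k + 1)).starProjection_apply_mem x
  refine ⟨x - (hv.valuationSubspace V (k + 1)).starProjection x, ⟨?_, ?_⟩,
    (hv.valuationSubspace V (k + 1)).starProjection x, hv1, by abel⟩
  · refine Submodule.sub_mem _ hx ⟨hv1.1, le_trans ?_ hv1.2⟩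
    exact_mod_cast Nat.le_succ k
  · exact (hv.valuationSubspace V (k + 1)).sub_starProjection_mem_orthogonal x

/-- The range of P_m^H is orthogonal to H_{m+1} by construction. Together with
`succ_le_of_projection_eq_zero` this says that P_m^H detects exactly the leading term of an element
of H_m. -/
theorem projection_eq_zero (hv : IsValuationHilbertModule ordR ord) {m : ℕ} {v : H}
    (h : (m + 1 : ℕ) ≤ ord v) : hv.projection m v = 0 := by
  have := hv.hasOrthogonalProjection_component_top m
  rw [projection, Submodule.starProjection_apply_eq_zero_iff]
  refine (Submodule.mem_orthogonal _ _).2 fun u hu => ?_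
  exact Submodule.inner_left_of_mem_orthogonal (hv.mem_valuationSubspace (V := ⊤).2 ⟨trivial, h⟩) hu.2

theorem succ_le_of_projection_eq_zero (hv : IsValuationHilbertModule ordR ord) {m : ℕ} {v : H}
    (h : (m : ℕ∞) ≤ ord v) (h0 : hv.projection m v = 0) : (m + 1 : ℕ) ≤ ord v := by
  have := hv.hasOrthogonalProjection_component_top m
  obtain ⟨w, hw, u, hu, rfl⟩ := hv.exists_component_add (V := ⊤) isClosed_univ
    (hv.mem_valuationSubspace.2 ⟨trivial, h⟩)
  rw [map_add, hv.projection_eq_zero hu.2, add_zero, projection,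
    Submodule.starProjection_eq_self_iff.2 hw] at h0
  rw [h0, zero_add]
  exact hu.2

/-- The near homogeneous components of a closed subspace `V` span a dense subspace of `V`. -/
theorem le_of_component_le (hv : IsValuationHilbertModule ordR ord) {V M : Submodule ℂ H}
    (hV : IsClosed (V : Set H)) (hM : IsClosed (M : Set H)) (h : ∀ k, hv.component V k ≤ M) :
    V ≤ M := by
  have := hv.hilbertModule.complete
  have : CompleteSpace (V ⊓ M : Submodule ℂ H) := (hV.inter hM).completeSpace_coe
  intro x hx
  have hp := (V ⊓ M).starProjection_apply_mem x
  set b := x - (V ⊓ M).starProjection x with hb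
  have hbV : b ∈ V := V.sub_mem hx hp.1
  have hbo : b ∈ (V ⊓ M)ᗮ := (V ⊓ M).sub_starProjection_mem_orthogonal x
  -- If b ∈ V_k, write b = w + v with w ∈ W_k and v ∈ V_{k+1}. Then w lies in V ∩ M, to which b is
  -- orthogonal, and w ⟂ v, so w = 0 and b ∈ V_{k+1}.
  have key : ∀ k : ℕ, (k : ℕ∞) ≤ ord b := by
    intro k
    induction k with
    | zero => simp
    | succ k ih =>
      obtain ⟨w, hw, v, hvv, e⟩ := hv.exists_component_add hV
        (hv.mem_valuationSubspace.2 ⟨hbV, ih⟩)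
      have hwb : inner ℂ w b = 0 :=
        Submodule.inner_right_of_mem_orthogonal (K := V ⊓ M) ⟨hw.1.1, h k hw⟩ hbo
      have hwv : inner ℂ w v = 0 := Submodule.inner_left_of_mem_orthogonal hvv hw.2
      rw [e, inner_add_right, hwv, add_zero, inner_self_eq_zero] at hwb
      rw [e, hwb, zero_add]
      exact hvv.2
  have hb0 : b = 0 := (hv.moduleValuation.ord_eq_top_iff b).1 (ENat.eq_top_iff_forall_ge.2 key)
  rw [sub_eq_zero.1 hb0]
  exact hp.2

theorem isNearInner_of_invariant (hv : IsValuationHilbertModule ordR ord) {V : Submodule ℂ H}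
    (hinv : ∀ r : R, 1 ≤ ordR r → ∀ h ∈ V, r • h ∈ V) : hv.IsNearInner V := by
  intro k m h hh g hg r hr hlt
  refine (Submodule.mem_orthogonal _ _).2 fun u hu => ?_
  refine Submodule.inner_left_of_mem_orthogonal (K := hv.valuationSubspace V (m + 1)) ?_ hu.2
  refine ⟨V.add_mem (hinv r hr h hh.1.1) hg, ?_⟩
  push_cast
  exact Order.add_one_le_of_lt hlt

theorem hasFullProjection_of_invariant (hv : IsValuationHilbertModule ordR ord)
    {V : Submodule ℂ H} (hV : IsClosed (V : Set H))
    (hinv : ∀ r : R, 1 ≤ ordR r → ∀ h ∈ V, r • h ∈ V) : hv.HasFullProjection V := by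
  intro k m r hr h hh g hg hle
  obtain ⟨w, hw, v, hvv, e⟩ := hv.exists_component_add hV
    (hv.mem_valuationSubspace.2 ⟨V.add_mem (hinv r hr h hh.1.1) hg, hle⟩)
  exact ⟨w, hw, by rw [e, map_add, hv.projection_eq_zero hvv.2, add_zero]⟩

/-- By density it suffices to treat h in a component of V. There the part of rh orthogonal to V
cannot have a finite order: full projection would match its leading term by some w ∈ W_m, and near
innerness would force w = 0. -/
theorem invariant_of_isNearInner (hv : IsValuationHilbertModule ordR ord) {V : Submodule ℂ H}
    (hV : IsClosed (V : Set H)) (hn : hv.IsNearInner V) (hf : hv.HasFullProjection V) {r : R}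
    (hr : 1 ≤ ordR r) : ∀ h ∈ V, r • h ∈ V := by
  have := hv.hilbertModule.complete
  have : CompleteSpace V := hV.completeSpace_coe
  let M : Submodule ℂ H :=
    { carrier := {h | r • h ∈ V}
      zero_mem' := by simp
      add_mem' := fun {a b} ha hb => by
        change r • (a + b) ∈ V
        rw [smul_add]
        exact V.add_mem ha hb
      smul_mem' := fun c h hh => by
        -- The two scalar actions are linked only by (c r) h = c (r h). So c h is rewritten as (c 1)
        -- h, which can be moved past r inside the algebra.
        have h1 := hv.hilbertModule.smul_assoc c 1
        have h2 := hv.hilbertModule.smul_assoc c r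
        simp only [one_smul] at h1
        change r • (c • h) ∈ V
        rw [← h1, smul_smul, mul_smul_comm, mul_one, h2]
        exact V.smul_mem c hh }
  have hM : IsClosed (M : Set H) := hV.preimage (hv.hilbertModule.continuous_smul r)
  refine hv.le_of_component_le hV hM fun k h hh => ?_
  change r • h ∈ V
  -- With this g, the element rh + g is the component of rh orthogonal to V.
  set g := -V.starProjection (r • h) with hg
  have hgV : g ∈ V := V.neg_mem (V.starProjection_apply_mem _)
  have hx : r • h + g ∈ Vᗮ := by
    rw [hg, ← sub_eq_add_neg]
    exact V.sub_starProjection_mem_orthogonal _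
  suffices h0 : r • h + g = 0 by
    rw [eq_neg_of_add_eq_zero_left h0]
    exact V.neg_mem hgV
  rw [← hv.moduleValuation.ord_eq_top_iff]
  by_contra hne
  obtain ⟨m, hm⟩ := ENat.ne_top_iff_exists.1 hne
  obtain ⟨w, hw, hwe⟩ := hf k m r hr h hh g hgV hm.le
  -- Both rh + g and w lie in H_m and have the same image under P_m^H, so their difference lies in
  -- H_{m+1}. As g - w is again in V, near innerness applies to it.
  have hord : (m + 1 : ℕ) ≤ ord (r • h + (g - w)) := by
    have e : r • h + (g - w) = (r • h + g) + (-1 : ℂ) • w := by rw [neg_one_smul]; abel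
    rw [e]
    refine hv.succ_le_of_projection_eq_zero (le_trans (le_min hm.le ?_)
      (hv.moduleValuation.ord_add _ _)) ?_
    · rw [hv.moduleValuation.ord_smul _ _ (by norm_num)]
      exact hw.1.2
    · rw [map_add, map_smul, hwe, neg_one_smul, add_neg_cancel]
  have hlt : (m : ℕ∞) < ord (r • h + (g - w)) := lt_of_lt_of_le (by exact_mod_cast m.lt_succ_self) hord
  have hperp := hn k m h hh (g - w) (V.sub_mem hgV hw.1.1) r hr hlt
  have e1 : inner ℂ w (r • h + (g - w)) = 0 := Submodule.inner_right_of_mem_orthogonal hw hperp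
  have e2 : inner ℂ w (r • h + g) = 0 := Submodule.inner_right_of_mem_orthogonal hw.1.1 hx
  have e3 : r • h + (g - w) = (r • h + g) - w := by abel
  rw [e3, inner_sub_right, e2, zero_sub, neg_eq_zero, inner_self_eq_zero] at e1
  rw [e1, sub_zero, ← hm] at hlt
  exact lt_irrefl _ hlt

/-- The abstract Beurling theorem, for valuation algebras `R = ℂ + R₁`. -/
theorem beurlingCharacterization (hv : IsValuationHilbertModule ordR ord)
    (hR : ∀ r : R, ∃ c : ℂ, 1 ≤ ordR (r - algebraMap ℂ R c)) : hv.BeurlingCharacterization := by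
  intro V hV
  have h1 : (∀ r : R, 1 ≤ ordR r → ∀ h ∈ V, r • h ∈ V) ↔
      hv.IsNearInner V ∧ hv.HasFullProjection V :=
    ⟨fun h => ⟨hv.isNearInner_of_invariant h, hv.hasFullProjection_of_invariant hV h⟩,
      fun h r hr => hv.invariant_of_isNearInner hV h.1 h.2 hr⟩
  refine ⟨h1, ?_⟩
  rw [← h1]
  refine ⟨fun h r _ => h r, fun h r x hx => ?_⟩
  obtain ⟨c, hc⟩ := hR r
  -- The first term is covered by the invariance under R₁, the second by linearity of V.
  have e : r • x = (r - algebraMap ℂ R c) • x + c • x := by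
    have := hv.hilbertModule.smul_assoc c 1 x
    rw [← Algebra.algebraMap_eq_smul_one, one_smul] at this
    rw [sub_smul, this, sub_add_cancel]
  rw [e]
  exact V.add_mem (h _ hc x hx) (V.smul_mem c hx)

end IsValuationHilbertModule

/-! ### The order of a zero -/

section OrderOfZero

variable {n : ℕ} {F : Type*} [NormedAddCommGroup F] [NormedSpace ℂ F]

theorem le_orderOfZero_iff {f : (Fin n → ℂ) → F} {z : Fin n → ℂ} {m : ℕ} :
    (m : ℕ∞) ≤ orderOfZero f z ↔ ∀ j < m, iteratedFDeriv ℂ j f z = 0 := by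
  simp only [orderOfZero, le_iInf_iff, mem_ofPred_eq, Nat.cast_le]
  refine forall_congr' fun j => ?_
  rw [← not_imp_not, not_le, not_not]

theorem orderOfZero_eq_top_iff {f : (Fin n → ℂ) → F} {z : Fin n → ℂ} :
    orderOfZero f z = ⊤ ↔ ∀ j, iteratedFDeriv ℂ j f z = 0 := by
  simp only [ENat.eq_top_iff_forall_ge, le_orderOfZero_iff]
  exact ⟨fun h j => h (j + 1) j j.lt_succ_self, fun h _ j _ => h j⟩

theorem le_of_forall_natCast_le {a b : ℕ∞} (h : ∀ m : ℕ, (m : ℕ∞) ≤ a → (m : ℕ∞) ≤ b) : a ≤ b :=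
  ENat.forall_natCast_le_iff_le.1 h

theorem one_le_orderOfZero_iff {f : (Fin n → ℂ) → F} {z : Fin n → ℂ} :
    1 ≤ orderOfZero f z ↔ f z = 0 := by
  rw [← Nat.cast_one, le_orderOfZero_iff]
  simp only [Nat.lt_one_iff, forall_eq]
  rw [← norm_eq_zero, norm_iteratedFDeriv_zero, norm_eq_zero]

variable [CompleteSpace F]

theorem orderOfZero_add_le {f g : (Fin n → ℂ) → F} {z : Fin n → ℂ} (hf : AnalyticAt ℂ f z)
    (hg : AnalyticAt ℂ g z) : min (orderOfZero f z) (orderOfZero g z) ≤ orderOfZero (f + g) z := by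
  refine le_of_forall_natCast_le fun m hm => ?_
  rw [le_min_iff, le_orderOfZero_iff, le_orderOfZero_iff] at hm
  refine le_orderOfZero_iff.2 fun j hj => ?_
  rw [iteratedFDeriv_add_apply hf.contDiffAt hg.contDiffAt, hm.1 j hj, hm.2 j hj, add_zero]

theorem orderOfZero_const_smul {f : (Fin n → ℂ) → F} {z : Fin n → ℂ} (hf : AnalyticAt ℂ f z)
    {c : ℂ} (hc : c ≠ 0) : orderOfZero (c • f) z = orderOfZero f z := by
  have : ∀ j, iteratedFDeriv ℂ j (c • f) z = c • iteratedFDeriv ℂ j f z := fun j =>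
    iteratedFDeriv_const_smul_apply hf.contDiffAt
  simp [orderOfZero, this, hc]

/-- In Leibniz' formula for the j-th derivative with j < ord r + ord f, each term contains a
derivative of r or of f of too low an order to be nonzero. -/
theorem orderOfZero_smul_le {r : (Fin n → ℂ) → ℂ} {f : (Fin n → ℂ) → F} {z : Fin n → ℂ}
    (hr : AnalyticAt ℂ r z) (hf : AnalyticAt ℂ f z) :
    orderOfZero r z + orderOfZero f z ≤ orderOfZero (fun w => r w • f w) z := by
  obtain ⟨s, hs, hso, hzs⟩ := eventually_nhds_iff.1
    (hr.eventually_analyticAt.and hf.eventually_analyticAt)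
  have key : ∀ j, ‖iteratedFDeriv ℂ j (fun w => r w • f w) z‖ ≤ ∑ i ∈ Finset.range (j + 1),
      (j.choose i : ℝ) * ‖iteratedFDeriv ℂ i r z‖ * ‖iteratedFDeriv ℂ (j - i) f z‖ := by
    intro j
    have h1 : ContDiffOn ℂ ω r s := fun w hw => (hs w hw).1.contDiffAt.contDiffWithinAt
    have h2 : ContDiffOn ℂ ω f s := fun w hw => (hs w hw).2.contDiffAt.contDiffWithinAt
    have := norm_iteratedFDerivWithin_smul_le h1 h2 hso.uniqueDiffOn hzs (n := j) le_top
    simpa only [iteratedFDerivWithin_of_isOpen _ hso hzs] using this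
  refine le_of_forall_natCast_le fun m hm => ?_
  refine le_orderOfZero_iff.2 fun j hj => ?_
  rw [← norm_le_zero_iff]
  refine (key j).trans (Finset.sum_nonpos fun i hi => le_of_eq ?_)
  by_cases h1 : (i + 1 : ℕ) ≤ orderOfZero r z
  · rw [le_orderOfZero_iff.1 h1 i i.lt_succ_self, norm_zero, mul_zero, zero_mul]
  · by_cases h2 : (j - i + 1 : ℕ) ≤ orderOfZero f z
    · rw [le_orderOfZero_iff.1 h2 _ (Nat.lt_succ_self _), norm_zero, mul_zero]
    · exfalso
      have a1 : orderOfZero r z ≤ i := by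
        rw [not_le] at h1; exact Order.le_of_lt_add_one (by exact_mod_cast h1)
      have a2 : orderOfZero f z ≤ (j - i : ℕ) := by
        rw [not_le] at h2; exact Order.le_of_lt_add_one (by exact_mod_cast h2)
      have a3 := hm.trans (add_le_add a1 a2)
      have : m ≤ i + (j - i) := by exact_mod_cast a3
      rw [Finset.mem_range] at hi
      omega

/-- Near z an analytic function is the sum of its Taylor series, so it vanishes there as soon as all
its derivatives at z do. -/
theorem orderOfZero_eq_top_iff_eventually {f : (Fin n → ℂ) → F} {z : Fin n → ℂ}
    (hf : AnalyticAt ℂ f z) : orderOfZero f z = ⊤ ↔ f =ᶠ[𝓝 z] 0 := by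
  rw [orderOfZero_eq_top_iff]
  constructor
  · intro h
    obtain ⟨p, r, hp⟩ := hf
    have hb : ∀ᶠ w in 𝓝 z, w - z ∈ Metric.eball (0 : Fin n → ℂ) r := by
      have : ContinuousAt (fun w => w - z) z := by fun_prop
      refine this.eventually_mem ?_
      rw [sub_self]
      exact Metric.eball_mem_nhds _ hp.r_pos
    filter_upwards [hb] with w hw
    have := hp.hasSum_iteratedFDeriv hw
    simp only [h, zero_apply, smul_zero, add_sub_cancel] at this
    exact this.unique hasSum_zero
  · intro h j
    have := (h.iteratedFDeriv ℂ j).self_of_nhds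
    simpa [Pi.zero_def, iteratedFDeriv_fun_zero] using this

end OrderOfZero

/-! ### Cauchy's estimates and Weierstrass' theorem -/

section Cauchy

variable {X F : Type*} [NormedAddCommGroup X] [NormedSpace ℂ X] [NormedAddCommGroup F]
  [NormedSpace ℂ F]

/-- Cauchy's estimate for the first derivative of an analytic function on a normed space. -/
theorem norm_fderiv_le_of_forall_mem_closedBall {f : X → F} {z : X} {δ M : ℝ} (hδ : 0 < δ)
    (hM : 0 ≤ M) (hf : ∀ w ∈ Metric.closedBall z δ, DifferentiableAt ℂ f w)
    (hb : ∀ w ∈ Metric.closedBall z δ, ‖f w‖ ≤ M) : ‖fderiv ℂ f z‖ ≤ M / δ := by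
  refine ContinuousLinearMap.opNorm_le_bound _ (by positivity) fun v => ?_
  rcases eq_or_ne v 0 with rfl | hv
  · simp
  have hv' : 0 < ‖v‖ := norm_pos_iff.2 hv
  have hmem : ∀ c ∈ Metric.closedBall (0 : ℂ) (δ / ‖v‖), z + c • v ∈ Metric.closedBall z δ := by
    intro c hc
    rw [mem_closedBall_zero_iff, le_div_iff₀ hv'] at hc
    simpa [mem_closedBall_iff_norm, norm_smul] using hc
  have hd : ∀ c ∈ Metric.closedBall (0 : ℂ) (δ / ‖v‖),
      DifferentiableAt ℂ (fun c : ℂ => f (z + c • v)) c := fun c hc =>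
    (hf _ (hmem c hc)).comp c (by fun_prop)
  have hpos : 0 < δ / ‖v‖ := by positivity
  have h1 := Complex.norm_deriv_le_of_forall_mem_sphere_norm_le (f := fun c : ℂ => f (z + c • v))
    (c := 0) (C := M) hpos
    (DifferentiableOn.diffContOnCl (fun c hc => (hd c (by rwa [closure_ball _ hpos.ne'] at hc)).differentiableWithinAt))
    (fun c hc => hb _ (hmem c (Metric.sphere_subset_closedBall hc)))
  have h2 : HasDerivAt (fun c : ℂ => f (z + c • v)) (fderiv ℂ f z v) 0 := by
    have h0 : HasFDerivAt f (fderiv ℂ f z) (z + (0 : ℂ) • v) := by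
      rw [zero_smul, add_zero]
      exact (hf z (Metric.mem_closedBall_self hδ.le)).hasFDerivAt
    have h3 : HasDerivAt (fun c : ℂ => z + c • v) v 0 := by
      simpa using ((hasDerivAt_id (0 : ℂ)).smul_const v).const_add z
    exact h0.comp_hasDerivAt (0 : ℂ) h3
  rw [h2.deriv] at h1
  calc _ ≤ M / (δ / ‖v‖) := h1
    _ = M / δ * ‖v‖ := by field_simp

theorem le_radius_of_norm_le_geometric {p : FormalMultilinearSeries ℂ X F} {C R : ℝ} (hR : 0 < R)
    (hp : ∀ m, ‖p m‖ ≤ C * (Real.exp 1 / R) ^ m) :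
    ENNReal.ofReal (R / Real.exp 1) ≤ p.radius := by
  refine p.le_radius_of_bound C fun m => ?_
  have he := Real.exp_pos 1
  rw [Real.coe_toNNReal _ (by positivity)]
  calc _ ≤ C * (Real.exp 1 / R) ^ m * (R / Real.exp 1) ^ m := by gcongr; exact hp m
    _ = C := by
      rw [mul_assoc, ← mul_pow]
      have : Real.exp 1 / R * (R / Real.exp 1) = 1 := by field_simp
      rw [this, one_pow, mul_one]

variable [CompleteSpace F]

/-- The first-order estimate is iterated; each differentiation costs δ in the radius and a factor
1/δ in the bound. -/
theorem norm_iteratedFDeriv_le_of_forall_mem_ball {f : X → F} {z₀ : X} {R M δ : ℝ}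
    (hf : AnalyticOnNhd ℂ f (Metric.ball z₀ R)) (hM : 0 ≤ M)
    (hb : ∀ z ∈ Metric.ball z₀ R, ‖f z‖ ≤ M) (hδ : 0 < δ) (m : ℕ) :
    ∀ z ∈ Metric.ball z₀ (R - m * δ), ‖iteratedFDeriv ℂ m f z‖ ≤ M / δ ^ m := by
  induction m with
  | zero => simpa using hb
  | succ m ih =>
    intro z hz
    have hsub : Metric.closedBall z δ ⊆ Metric.ball z₀ (R - m * δ) := by
      refine Metric.closedBall_subset_ball' ?_
      rw [Metric.mem_ball] at hz
      push_cast at hz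
      linarith
    rw [← norm_fderiv_iteratedFDeriv, pow_succ, ← div_div]
    refine norm_fderiv_le_of_forall_mem_closedBall hδ (by positivity) (fun w hw => ?_)
      fun w hw => ih w (hsub hw)
    refine (hf.iteratedFDeriv m w (Metric.ball_subset_ball ?_ (hsub hw))).differentiableAt
    have : 0 ≤ m * δ := by positivity
    linarith

theorem norm_iteratedFDeriv_center_le {f : X → F} {z₀ : X} {R M : ℝ} (hR : 0 < R)
    (hf : AnalyticOnNhd ℂ f (Metric.ball z₀ R)) (hM : 0 ≤ M)
    (hb : ∀ z ∈ Metric.ball z₀ R, ‖f z‖ ≤ M) (m : ℕ) :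
    ‖iteratedFDeriv ℂ m f z₀‖ ≤ M / (R / (m + 1)) ^ m := by
  -- With δ = R/(m + 1), the ball that remains after m steps has radius R - mδ = δ > 0.
  refine norm_iteratedFDeriv_le_of_forall_mem_ball hf hM hb (by positivity) m z₀
    (Metric.mem_ball_self ?_)
  have : (m : ℝ) * (R / (m + 1)) = R - R / (m + 1) := by field_simp; ring
  rw [this, sub_sub_cancel]
  positivity

/-- The Taylor series of `f` at `z₀`. -/
noncomputable def taylorAt (f : X → F) (z₀ : X) : FormalMultilinearSeries ℂ X F := fun m =>
  (m.factorial : ℂ)⁻¹ • iteratedFDeriv ℂ m f z₀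

/-- Dividing by m! turns the factor (m + 1)^m of the iterated estimate into one of at most e^(m+1).
So the bound is geometric with ratio e/R, at the price of a radius of convergence R/e in place of R.
-/
theorem norm_taylorAt_le {f : X → F} {z₀ : X} {R M : ℝ} (hR : 0 < R)
    (hf : AnalyticOnNhd ℂ f (Metric.ball z₀ R)) (hM : 0 ≤ M)
    (hb : ∀ z ∈ Metric.ball z₀ R, ‖f z‖ ≤ M) (m : ℕ) :
    ‖taylorAt f z₀ m‖ ≤ M * Real.exp 1 * (Real.exp 1 / R) ^ m := by
  have h1 := norm_iteratedFDeriv_center_le hR hf hM hb m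
  -- The inequality x^N/N! ≤ e^x at x = N = m + 1, whose left side equals (m + 1)^m/m!.
  have h2 := Real.pow_div_factorial_le_exp (x := (m + 1 : ℝ)) (by positivity) (m + 1)
  have h3 : (m + 1 : ℝ) ^ m / m.factorial ≤ Real.exp 1 * Real.exp 1 ^ m := by
    rw [← pow_succ', ← Real.exp_nat_mul, mul_one]
    push_cast
    refine le_of_eq_of_le ?_ h2
    rw [Nat.factorial_succ, pow_succ]
    push_cast
    field_simp
  rw [taylorAt, norm_smul, norm_inv, Complex.norm_natCast]
  calc _ ≤ (m.factorial : ℝ)⁻¹ * (M / (R / (m + 1)) ^ m) := by gcongr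
    _ = M / R ^ m * ((m + 1 : ℝ) ^ m / m.factorial) := by rw [div_pow]; field_simp
    _ ≤ M / R ^ m * (Real.exp 1 * Real.exp 1 ^ m) := by gcongr
    _ = _ := by rw [div_pow]; field_simp

/-- The geometric bound makes the Taylor series converge on the ball of radius R/e. Its sum is
analytic and agrees with f near z₀, hence on the whole ball by the identity theorem. -/
theorem hasSum_taylorAt {f : X → F} {z₀ : X} {R M : ℝ} (hR : 0 < R)
    (hf : AnalyticOnNhd ℂ f (Metric.ball z₀ R)) (hM : 0 ≤ M)
    (hb : ∀ z ∈ Metric.ball z₀ R, ‖f z‖ ≤ M) {y : X} (hy : ‖y‖ < R / Real.exp 1) :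
    HasSum (fun m => taylorAt f z₀ m fun _ => y) (f (z₀ + y)) := by
  have he := Real.exp_pos 1
  set ρ := R / Real.exp 1 with hρ
  have hρ0 : 0 < ρ := by positivity
  have hρR : ρ ≤ R := div_le_self hR.le (Real.one_le_exp zero_le_one)
  set p := taylorAt f z₀
  have hrad : ENNReal.ofReal ρ ≤ p.radius :=
    le_radius_of_norm_le_geometric hR (norm_taylorAt_le hR hf hM hb)
  have hrad0 : 0 < p.radius := (ENNReal.ofReal_pos.2 hρ0).trans_le hrad
  have hpsum := (p.hasFPowerSeriesOnBall hrad0).mono (ENNReal.ofReal_pos.2 hρ0) hrad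
  have hps2 : HasFPowerSeriesOnBall (fun z => p.sum (z - z₀)) p z₀ (ENNReal.ofReal ρ) := by
    simpa using hpsum.comp_sub z₀
  have han1 : AnalyticOnNhd ℂ (fun z => p.sum (z - z₀)) (Metric.ball z₀ ρ) := by
    have := hps2.analyticOnNhd
    rwa [Metric.eball_ofReal] at this
  have heq : (fun z => p.sum (z - z₀)) =ᶠ[𝓝 z₀] f := by
    obtain ⟨q, r, hq⟩ := hf z₀ (Metric.mem_ball_self hR)
    have hb : ∀ᶠ w in 𝓝 z₀, w - z₀ ∈ Metric.eball (0 : X) r := by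
      have : ContinuousAt (fun w => w - z₀) z₀ := by fun_prop
      refine this.eventually_mem ?_
      rw [sub_self]
      exact Metric.eball_mem_nhds _ hq.r_pos
    filter_upwards [hb] with w hw
    have := hq.hasSum_iteratedFDeriv hw
    rw [add_sub_cancel] at this
    exact this.tsum_eq
  have hEq := han1.eqOn_of_preconnected_of_eventuallyEq (hf.mono (Metric.ball_subset_ball hρR))
    (convex_ball z₀ ρ).isPreconnected (Metric.mem_ball_self hρ0) heq
  have hy' : z₀ + y ∈ Metric.ball z₀ ρ := by simpa [mem_ball_iff_norm] using hy
  have h2 := hEq hy'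
  simp only [add_sub_cancel_left] at h2
  rw [← h2]
  refine p.hasSum (Metric.eball_subset_eball hrad ?_)
  rwa [Metric.eball_ofReal, mem_ball_zero_iff]

/-- For each m the m-th Taylor coefficients form a Cauchy sequence. All obey one common geometric
bound, so limit and summation can be interchanged by dominated convergence, and the limit
coefficients form a power series for g. -/
theorem analyticAt_of_uniformCauchySeqOn_of_bounded {f : ℕ → X → F} {g : X → F} {z₀ : X}
    {R M : ℝ} (hR : 0 < R) (hf : ∀ j, AnalyticOnNhd ℂ (f j) (Metric.ball z₀ R)) (hM : 0 ≤ M)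
    (hb : ∀ j, ∀ z ∈ Metric.ball z₀ R, ‖f j z‖ ≤ M)
    (hc : UniformCauchySeqOn f atTop (Metric.ball z₀ R))
    (hg : ∀ z ∈ Metric.ball z₀ R, Tendsto (fun j => f j z) atTop (𝓝 (g z))) :
    AnalyticAt ℂ g z₀ := by
  have he := Real.exp_pos 1
  have hz₀ := Metric.mem_ball_self (x := z₀) hR
  have hcauchy : ∀ m, CauchySeq fun j => taylorAt (f j) z₀ m := by
    intro m
    refine Metric.cauchySeq_iff.2 fun ε hε => ?_
    set K := Real.exp 1 * (Real.exp 1 / R) ^ m with hK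
    have hK0 : 0 < K := by positivity
    obtain ⟨N, hN⟩ := Metric.uniformCauchySeqOn_iff.1 hc (ε / (2 * K)) (by positivity)
    refine ⟨N, fun i hi j hj => ?_⟩
    -- The coefficient estimate for f i - f j, which is bounded by ε/(2K), gives at most ε/2.
    have h1 := norm_taylorAt_le hR ((hf i).sub (hf j)) (M := ε / (2 * K)) (by positivity)
      (fun z hz => by
        have := hN i hi j hj z hz
        rw [dist_eq_norm] at this
        exact this.le) m
    have h2 : taylorAt (f i - f j) z₀ m = taylorAt (f i) z₀ m - taylorAt (f j) z₀ m := by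
      rw [taylorAt, iteratedFDeriv_sub_apply (hf i z₀ hz₀).contDiffAt (hf j z₀ hz₀).contDiffAt,
        smul_sub]
      rfl
    rw [dist_eq_norm, ← h2]
    refine h1.trans_lt ?_
    rw [mul_assoc, ← hK]
    have : ε / (2 * K) * K = ε / 2 := by field_simp
    rw [this]
    linarith
  choose p hp using fun m => cauchySeq_tendsto_of_complete (hcauchy m)
  have hpb : ∀ m, ‖p m‖ ≤ M * Real.exp 1 * (Real.exp 1 / R) ^ m := fun m =>
    le_of_tendsto (hp m).norm (Eventually.of_forall fun j =>
      norm_taylorAt_le hR (hf j) hM (hb j) m)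
  set ρ := R / Real.exp 1 with hρ
  have hρ0 : 0 < ρ := by positivity
  have hρR : ρ ≤ R := div_le_self hR.le (Real.one_le_exp zero_le_one)
  refine ⟨p, ENNReal.ofReal ρ, ⟨le_radius_of_norm_le_geometric hR hpb,
    ENNReal.ofReal_pos.2 hρ0, fun {y} hy => ?_⟩⟩
  rw [Metric.eball_ofReal, mem_ball_zero_iff] at hy
  set B : ℕ → ℝ := fun m => M * Real.exp 1 * (Real.exp 1 / R * ‖y‖) ^ m
  have hBs : Summable B := by
    refine (summable_geometric_of_lt_one (by positivity) ?_).mul_left _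
    rw [hρ, lt_div_iff₀ he] at hy
    rw [div_mul_eq_mul_div, div_lt_one hR, mul_comm]
    exact hy
  have hterm : ∀ (q : FormalMultilinearSeries ℂ X F),
      (∀ m, ‖q m‖ ≤ M * Real.exp 1 * (Real.exp 1 / R) ^ m) → ∀ m, ‖q m fun _ => y‖ ≤ B m := by
    intro q hq m
    refine ((q m).le_opNorm _).trans ?_
    rw [Finset.prod_const, Finset.card_univ, Fintype.card_fin]
    simp only [B]
    rw [mul_pow, ← mul_assoc]
    gcongr
    exact hq m
  have hlim := tendsto_tsum_of_dominated_convergence (𝓕 := atTop)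
    (f := fun j m => taylorAt (f j) z₀ m fun _ => y) (g := fun m => p m fun _ => y) hBs
    (fun m => ((ContinuousMultilinearMap.apply ℂ (fun _ => X) F fun _ => y).continuous.tendsto
      _).comp (hp m))
    (Eventually.of_forall fun j m => hterm _ (norm_taylorAt_le hR (hf j) hM (hb j)) m)
  have hsum : Summable fun m => p m fun _ => y := Summable.of_norm_bounded hBs (hterm p hpb)
  have hy' : z₀ + y ∈ Metric.ball z₀ R := by
    simpa [mem_ball_iff_norm] using hy.trans_le hρR
  have hlim2 := hg _ hy'
  have : ∀ j, ∑' m, (taylorAt (f j) z₀ m fun _ => y) = f j (z₀ + y) := fun j =>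
    (hasSum_taylorAt hR (hf j) hM (hb j) hy).tsum_eq
  simp only [this] at hlim
  rw [tendsto_nhds_unique hlim2 hlim]
  exact hsum.hasSum

/-- Weierstrass' theorem: a locally uniform limit of analytic functions is analytic. -/
theorem analyticAt_of_uniformCauchySeqOn {f : ℕ → X → F} {g : X → F} {z₀ : X}
    {R : ℝ} (hR : 0 < R) (hf : ∀ j, AnalyticOnNhd ℂ (f j) (Metric.ball z₀ R))
    (hc : UniformCauchySeqOn f atTop (Metric.ball z₀ R))
    (hg : ∀ z ∈ Metric.ball z₀ R, Tendsto (fun j => f j z) atTop (𝓝 (g z))) :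
    AnalyticAt ℂ g z₀ := by
  obtain ⟨N, hN⟩ := Metric.uniformCauchySeqOn_iff.1 hc 1 one_pos
  -- Subtracting f N provides the uniform bound 1, although the f j themselves need not be bounded.
  have h := analyticAt_of_uniformCauchySeqOn_of_bounded (f := fun j => f (N + j) - f N)
    (g := g - f N) hR (fun j => (hf _).sub (hf _)) zero_le_one
    (fun j z hz => by
      have := hN (N + j) (Nat.le_add_right _ _) N le_rfl z hz
      rw [dist_eq_norm] at this
      exact this.le)
    (Metric.uniformCauchySeqOn_iff.2 fun ε hε => by
      obtain ⟨K, hK⟩ := Metric.uniformCauchySeqOn_iff.1 hc ε hε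
      refine ⟨K, fun i hi j hj z hz => ?_⟩
      simpa using hK (N + i) (by omega) (N + j) (by omega) z hz)
    (fun z hz => by
      refine Tendsto.sub_const ?_ _
      have := (hg z hz).comp (tendsto_add_atTop_nat N)
      simpa [Function.comp_def, add_comm] using this)
  have := h.add (hf N z₀ (Metric.mem_ball_self hR))
  simpa using this

end Cauchy

/-! ### Mean value inequalities on polydiscs -/

section MeanValue

variable {n : ℕ} {E : Type*} [NormedAddCommGroup E] [NormedSpace ℂ E] [CompleteSpace E]

theorem measurePreserving_unit_smul {c : ℂ} (hc : ‖c‖ = 1) :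
    MeasurePreserving (fun w : Fin n → ℂ => c • w) := by
  have h1 : MeasurePreserving (fun z : ℂ => c * z) :=
    (rotation ⟨c, mem_sphere_zero_iff_norm.2 hc⟩).measurePreserving
  exact volume_preserving_pi (fun _ : Fin n => h1)

/-- The mean value inequality on a circle inside a complex line. -/
theorem enorm_le_lintegral_circle {f : (Fin n → ℂ) → E} {z w : Fin n → ℂ}
    (hf : ∀ c ∈ Metric.closedBall (0 : ℂ) 1, DifferentiableAt ℂ f (z + c • w)) :
    ENNReal.ofReal (2 * Real.pi) * ‖f z‖ₑ ≤
      ∫⁻ θ in Ioc 0 (2 * Real.pi), ‖f (z + circleMap 0 1 θ • w)‖ₑ := by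
  have hd : DiffContOnCl ℂ (fun c : ℂ => f (z + c • w)) (Metric.ball 0 |1|) := by
    refine DifferentiableOn.diffContOnCl fun c hc => ?_
    rw [abs_one, closure_ball _ one_ne_zero] at hc
    exact ((hf c hc).comp c (by fun_prop)).differentiableWithinAt
  have h := hd.circleAverage
  rw [Real.circleAverage_def, zero_smul, add_zero,
    intervalIntegral.integral_of_le Real.two_pi_pos.le, inv_smul_eq_iff₀ Real.two_pi_pos.ne'] at h
  have h2 := enorm_integral_le_lintegral_enorm (μ := volume.restrict (Ioc 0 (2 * Real.pi)))
    (fun θ => f (z + circleMap 0 1 θ • w))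
  rw [h, enorm_smul, Real.enorm_of_nonneg Real.two_pi_pos.le] at h2
  exact h2

/-- The mean value inequality on a polydisc. -/
theorem enorm_mul_volume_le_lintegral {f : (Fin n → ℂ) → E} {z : Fin n → ℂ} {R : ℝ}
    (hf : AnalyticOnNhd ℂ f (Metric.ball z R)) :
    ‖f z‖ₑ * volume (Metric.ball z R) ≤ ∫⁻ w in Metric.ball z R, ‖f w‖ₑ := by
  classical
  set B := Metric.ball (0 : Fin n → ℂ) R
  set G : (Fin n → ℂ) → ℝ≥0∞ := B.piecewise (fun w => ‖f (z + w)‖ₑ) 0 with hG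
  have hmem : ∀ w ∈ B, z + w ∈ Metric.ball z R := fun w hw => by
    simpa [mem_ball_iff_norm, B] using hw
  have hGm : Measurable G := by
    refine ContinuousOn.measurable_piecewise ?_ continuousOn_const measurableSet_ball
    exact (hf.continuousOn.comp (by fun_prop) hmem).enorm
  have htr : ∫⁻ w in Metric.ball z R, ‖f w‖ₑ = ∫⁻ w, G w := by
    have h1 : G = B.indicator (fun w => ‖f (z + w)‖ₑ) := by
      rw [hG, Set.piecewise_eq_indicator]
    have h2 : ∀ w, G w = (Metric.ball z R).indicator (fun w => ‖f w‖ₑ) (z + w) := by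
      intro w
      rw [h1]
      simp only [indicator, B, mem_ball_iff_norm, add_sub_cancel_left, sub_zero]
    simp only [h2]
    rw [lintegral_add_left_eq_self (fun w => (Metric.ball z R).indicator (fun w => ‖f w‖ₑ) w) z,
      lintegral_indicator measurableSet_ball]
  have hvol : volume (Metric.ball z R) = volume B := by
    rw [Measure.addHaar_ball_center]
  have hrot : ∀ θ : ℝ, ∫⁻ w, G (circleMap 0 1 θ • w) = ∫⁻ w, G w := fun θ =>
    (measurePreserving_unit_smul (by simp)).lintegral_comp hGm
  have hpi : ENNReal.ofReal (2 * Real.pi) ≠ 0 := by simp [Real.pi_pos]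
  -- The inequality on the circle θ ↦ z + e^{iθ}w is integrated over w ∈ B and the integrals are
  -- swapped. For each θ the rotation w ↦ e^{iθ}w preserves volume, so the inner integral does not
  -- depend on θ.
  have hmain : ENNReal.ofReal (2 * Real.pi) * (‖f z‖ₑ * volume B) ≤
      ENNReal.ofReal (2 * Real.pi) * ∫⁻ w, G w := by
    calc ENNReal.ofReal (2 * Real.pi) * (‖f z‖ₑ * volume B)
        = ∫⁻ _ in B, ENNReal.ofReal (2 * Real.pi) * ‖f z‖ₑ := by
          rw [setLIntegral_const, mul_assoc]
      _ ≤ ∫⁻ w in B, ∫⁻ θ in Ioc 0 (2 * Real.pi), G (circleMap 0 1 θ • w) := by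
          refine setLIntegral_mono' measurableSet_ball fun w hw => ?_
          have hmul : ∀ c ∈ Metric.closedBall (0 : ℂ) 1, c • w ∈ B := fun c hc => by
            rw [mem_closedBall_zero_iff] at hc
            rw [mem_ball_zero_iff] at hw ⊢
            rw [norm_smul]
            exact (mul_le_of_le_one_left (norm_nonneg _) hc).trans_lt hw
          refine (enorm_le_lintegral_circle fun c hc =>
            (hf _ (hmem _ (hmul c hc))).differentiableAt).trans (lintegral_mono fun θ => ?_)
          rw [hG, Set.piecewise_eq_of_mem _ _ _ (hmul _ (by simp))]
      _ ≤ ∫⁻ w, ∫⁻ θ in Ioc 0 (2 * Real.pi), G (circleMap 0 1 θ • w) := setLIntegral_le_lintegral _ _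
      _ = ∫⁻ θ in Ioc 0 (2 * Real.pi), ∫⁻ w, G (circleMap 0 1 θ • w) := by
          refine lintegral_lintegral_swap (Measurable.aemeasurable ?_)
          refine hGm.comp (Continuous.measurable ?_)
          have := continuous_circleMap 0 1
          fun_prop
      _ = _ := by
          simp only [hrot, setLIntegral_const, Real.volume_Ioc, sub_zero]
          rw [mul_comm]
  rw [htr, hvol]
  exact (ENNReal.mul_le_mul_iff_right hpi ENNReal.ofReal_ne_top).1 hmain

/-- The mean value inequality for `‖f‖²` on a polydisc. -/
theorem enorm_sq_mul_volume_le_lintegral {f : (Fin n → ℂ) → E} {z : Fin n → ℂ} {R : ℝ}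
    (hR : 0 < R) (hf : AnalyticOnNhd ℂ f (Metric.ball z R)) :
    ‖f z‖ₑ ^ 2 * volume (Metric.ball z R) ≤ ∫⁻ w in Metric.ball z R, ‖f w‖ₑ ^ 2 := by
  have hv0 : volume (Metric.ball z R) ≠ 0 := (Metric.measure_ball_pos _ _ hR).ne'
  have hv1 : volume (Metric.ball z R) ≠ ⊤ := measure_ball_lt_top.ne
  have h1 := enorm_mul_volume_le_lintegral hf
  -- Cauchy–Schwarz against the constant 1. After squaring, one factor of the volume cancels.
  have h2 := ENNReal.lintegral_mul_le_Lp_mul_Lq (volume.restrict (Metric.ball z R))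
    Real.HolderConjugate.two_two (f := fun w => ‖f w‖ₑ) (g := fun _ => 1)
    (hf.continuousOn.enorm.aemeasurable measurableSet_ball) aemeasurable_const
  simp only [Pi.mul_apply, mul_one, lintegral_const,
    Measure.restrict_apply_univ, ENNReal.rpow_two] at h2
  have h3 := pow_le_pow_left₀ zero_le (h1.trans h2) 2
  rw [mul_pow, mul_pow, ← ENNReal.rpow_two (_ ^ (1 / 2 : ℝ)), ← ENNReal.rpow_two (_ ^ (1 / 2 : ℝ)),
    ← ENNReal.rpow_mul, ← ENNReal.rpow_mul] at h3
  norm_num at h3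
  rw [sq (volume _), ← mul_assoc] at h3
  exact (ENNReal.mul_le_mul_iff_left hv0 hv1).1 h3

end MeanValue

/-! ### Forms in local coordinates and the identity theorem -/

section Manifold

variable {n : ℕ} {Ω : Type*} [TopologicalSpace Ω] [ChartedSpace (Fin n → ℂ) Ω]
variable {E : Type*} [NormedAddCommGroup E] [InnerProductSpace ℂ E]

/-- The covector `α x`, on the model space of the tangent space at `x`. -/
def covectorAt (α : FormField n Ω E) (x : Ω) : (Fin n → ℂ) [⋀^Fin n]→L[ℂ] E := α x

/-- The coefficient of the covector `α x` in the model space of the tangent space at `x`. -/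
noncomputable def covectorCoeff (α : FormField n Ω E) (x : Ω) : E := covectorAt α x fun i => Pi.single i 1

/-- The derivative of the inverse of the chart `e`, on the model spaces of the tangent spaces. -/
noncomputable def chartSymmDeriv (e : OpenPartialHomeomorph Ω (Fin n → ℂ)) (z : Fin n → ℂ) :
    (Fin n → ℂ) →L[ℂ] (Fin n → ℂ) :=
  mfderiv 𝓘(ℂ, Fin n → ℂ) 𝓘(ℂ, Fin n → ℂ) e.symm z

/-- The complex Jacobian of the inverse of the chart `e`. -/
noncomputable def chartJacobian (e : OpenPartialHomeomorph Ω (Fin n → ℂ)) (z : Fin n → ℂ) : ℂ :=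
  (chartSymmDeriv e z).det

theorem det_of_single (A : (Fin n → ℂ) →L[ℂ] (Fin n → ℂ)) :
    (Matrix.of fun i => A (Pi.single i 1)).det = A.det := by
  rw [ContinuousLinearMap.det, ← LinearMap.det_toMatrix', ← Matrix.det_transpose]
  congr 1

/-- Covectors of top degree scale by the determinant, so a chart enters only through its Jacobian.
The factor `covectorCoeff` does not depend on the chart e, but it need not be continuous, since the
identification of the tangent spaces with the model space depends on the preferred chart at each
point. -/
theorem chartCoeff_eq (e : OpenPartialHomeomorph Ω (Fin n → ℂ)) (α : FormField n Ω E)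
    (z : Fin n → ℂ) :
    chartCoeff e α z = chartJacobian e z • covectorCoeff α (e.symm z) := by
  have h := covector_apply (covectorAt α (e.symm z)) fun i =>
    chartSymmDeriv e z (Pi.single i 1)
  rw [det_of_single] at h
  exact h

/-- The `(n, 0)`-form with given coefficients in the model spaces of the tangent spaces. -/
noncomputable def formOfCoeff (u : Ω → E) : FormField n Ω E := fun x =>
  (((ContinuousLinearMap.toSpanSingleton ℂ (u x)).compContinuousAlternatingMap
    { (Matrix.detRowAlternating : (Fin n → ℂ) [⋀^Fin n]→ₗ[ℂ] ℂ) with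
      cont := Continuous.matrix_det continuous_id } : (Fin n → ℂ) [⋀^Fin n]→L[ℂ] E))

theorem covectorCoeff_formOfCoeff (u : Ω → E) :
    covectorCoeff (formOfCoeff (n := n) u) = u := by
  funext x
  change (Matrix.det fun i : Fin n => (Pi.single i 1 : Fin n → ℂ)) • u x = u x
  have : (fun i : Fin n => (Pi.single i 1 : Fin n → ℂ)) = (1 : Matrix (Fin n) (Fin n) ℂ) := by
    ext i j
    simp [Matrix.one_apply, Pi.single_apply, eq_comm]
  rw [this, Matrix.det_one, one_smul]

theorem eq_of_covectorCoeff_eq {α β : FormField n Ω E}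
    (h : ∀ x, covectorCoeff α x = covectorCoeff β x) : α = β := by
  funext x
  have key : covectorAt α x = covectorAt β x := by
    ext v
    rw [covector_apply (covectorAt α x), covector_apply (covectorAt β x)]
    exact congrArg _ (h x)
  exact key

/-- The set where a family of analytic functions in local coordinates vanishes is all of a
connected manifold if it is a neighbourhood of some point. -/
theorem eq_univ_of_mem_nhds_of_analytic [PreconnectedSpace Ω] {F : Type*} [NormedAddCommGroup F]
    [NormedSpace ℂ F] {Z : Set Ω} {p : Ω} (hp : Z ∈ 𝓝 p)
    (hZ : ∀ x : Ω, ∃ f : (Fin n → ℂ) → F, AnalyticOnNhd ℂ f (chartAt (Fin n → ℂ) x).target ∧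
      ∀ y ∈ (chartAt (Fin n → ℂ) x).source, y ∈ Z ↔ f (chartAt (Fin n → ℂ) x y) = 0) :
    Z = univ := by
  have hclosed : IsClosed (interior Z) := by
    refine isClosed_of_closure_subset fun x hx => ?_
    obtain ⟨f, hf, hfZ⟩ := hZ x
    set e := chartAt (Fin n → ℂ) x
    have hxe : x ∈ e.source := mem_chart_source _ x
    -- A coordinate ball around the closure point x is connected and meets the interior of Z, so the
    -- identity theorem puts all of it in Z.
    obtain ⟨ρ, hρ, hball⟩ := Metric.isOpen_iff.1 e.open_target _ (e.map_source hxe)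
    have hopen : IsOpen (e.source ∩ e ⁻¹' Metric.ball (e x) ρ) :=
      e.isOpen_inter_preimage Metric.isOpen_ball
    obtain ⟨y, ⟨hye, hyb⟩, hyZ⟩ := mem_closure_iff.1 hx _ hopen ⟨hxe, Metric.mem_ball_self hρ⟩
    have hev : f =ᶠ[𝓝 (e y)] 0 := by
      have h1 : ∀ᶠ w in 𝓝 (e y), e.symm w ∈ interior Z := by
        refine (e.continuousAt_symm (e.map_source hye)).eventually_mem ?_
        rw [e.left_inv hye]
        exact isOpen_interior.mem_nhds hyZ
      filter_upwards [h1, e.open_target.mem_nhds (e.map_source hye)] with w hw hwt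
      have := (hfZ _ (e.map_target hwt)).1 (interior_subset hw)
      rwa [e.right_inv hwt] at this
    have h0 := (hf.mono hball).eqOn_zero_of_preconnected_of_eventuallyEq_zero
      (convex_ball (e x) ρ).isPreconnected hyb hev
    exact mem_interior.2 ⟨_, fun w hw => (hfZ w hw.1).2 (h0 hw.2), hopen,
      hxe, Metric.mem_ball_self hρ⟩
  have := IsClopen.eq_univ ⟨hclosed, isOpen_interior⟩ ⟨p, mem_interior_iff_mem_nhds.2 hp⟩
  exact univ_subset_iff.1 (this ▸ interior_subset)

theorem mdifferentiable_of_mem_maximalAtlas {e : OpenPartialHomeomorph Ω (Fin n → ℂ)}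
    (he : e ∈ IsManifold.maximalAtlas 𝓘(ℂ, Fin n → ℂ) ω Ω) :
    e.MDifferentiable 𝓘(ℂ, Fin n → ℂ) 𝓘(ℂ, Fin n → ℂ) :=
  ⟨(contMDiffOn_of_mem_maximalAtlas he).mdifferentiableOn (by simp),
    (contMDiffOn_symm_of_mem_maximalAtlas he).mdifferentiableOn (by simp)⟩

theorem analyticOnNhd_comp_symm {r : Ω → ℂ} (hr : ContMDiff 𝓘(ℂ, Fin n → ℂ) 𝓘(ℂ, ℂ) ω r)
    {e : OpenPartialHomeomorph Ω (Fin n → ℂ)}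
    (he : e ∈ IsManifold.maximalAtlas 𝓘(ℂ, Fin n → ℂ) ω Ω) :
    AnalyticOnNhd ℂ (r ∘ e.symm) e.target := by
  rw [← e.open_target.analyticOn_iff_analyticOnNhd, ← contDiffOn_omega_iff_analyticOn
    e.open_target.uniqueDiffOn, ← contMDiffOn_iff_contDiffOn]
  exact hr.comp_contMDiffOn (contMDiffOn_symm_of_mem_maximalAtlas he)

theorem chartJacobian_ne_zero {e : OpenPartialHomeomorph Ω (Fin n → ℂ)}
    (he : e ∈ IsManifold.maximalAtlas 𝓘(ℂ, Fin n → ℂ) ω Ω) {z : Fin n → ℂ} (hz : z ∈ e.target) :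
    chartJacobian e z ≠ 0 := by
  have h := (mdifferentiable_of_mem_maximalAtlas he).comp_symm_deriv hz
  let A : (Fin n → ℂ) →L[ℂ] (Fin n → ℂ) :=
    mfderiv 𝓘(ℂ, Fin n → ℂ) 𝓘(ℂ, Fin n → ℂ) e (e.symm z)
  have h2 : A.comp (chartSymmDeriv e z) = ContinuousLinearMap.id ℂ (Fin n → ℂ) := h
  have h3 : LinearMap.det ((A : (Fin n → ℂ) →ₗ[ℂ] (Fin n → ℂ)) ∘ₗ
      (chartSymmDeriv e z : (Fin n → ℂ) →ₗ[ℂ] (Fin n → ℂ))) = LinearMap.det LinearMap.id :=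
    congrArg (fun B : (Fin n → ℂ) →L[ℂ] (Fin n → ℂ) => B.det) h2
  rw [LinearMap.det_comp, LinearMap.det_id] at h3
  exact right_ne_zero_of_mul_eq_one h3

theorem chartCoeff_eq_zero_iff {e : OpenPartialHomeomorph Ω (Fin n → ℂ)}
    (he : e ∈ IsManifold.maximalAtlas 𝓘(ℂ, Fin n → ℂ) ω Ω) {z : Fin n → ℂ} (hz : z ∈ e.target)
    {α : FormField n Ω E} : chartCoeff e α z = 0 ↔ covectorCoeff α (e.symm z) = 0 := by
  rw [chartCoeff_eq, smul_eq_zero, or_iff_right (chartJacobian_ne_zero he hz)]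

theorem covectorCoeff_eq {e : OpenPartialHomeomorph Ω (Fin n → ℂ)}
    (he : e ∈ IsManifold.maximalAtlas 𝓘(ℂ, Fin n → ℂ) ω Ω) {x : Ω} (hx : x ∈ e.source)
    (α : FormField n Ω E) :
    covectorCoeff α x = (chartJacobian e (e x))⁻¹ • chartCoeff e α (e x) := by
  rw [chartCoeff_eq, e.left_inv hx, inv_smul_smul₀ (chartJacobian_ne_zero he (e.map_source hx))]

theorem differentiableAt_transition {e e' : OpenPartialHomeomorph Ω (Fin n → ℂ)}
    (he : e ∈ IsManifold.maximalAtlas 𝓘(ℂ, Fin n → ℂ) ω Ω)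
    (he' : e' ∈ IsManifold.maximalAtlas 𝓘(ℂ, Fin n → ℂ) ω Ω) {z : Fin n → ℂ} (hz : z ∈ e.target)
    (hz' : e.symm z ∈ e'.source) : DifferentiableAt ℂ (e' ∘ e.symm) z := by
  rw [← mdifferentiableAt_iff_differentiableAt]
  exact ((mdifferentiable_of_mem_maximalAtlas he').mdifferentiableAt hz').comp z
    ((mdifferentiable_of_mem_maximalAtlas he).mdifferentiableAt_symm hz)

/-- The chain rule for e⁻¹ = e'⁻¹ ∘ (e' ∘ e⁻¹) near z. -/
theorem chartJacobian_transition {e e' : OpenPartialHomeomorph Ω (Fin n → ℂ)}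
    (he : e ∈ IsManifold.maximalAtlas 𝓘(ℂ, Fin n → ℂ) ω Ω)
    (he' : e' ∈ IsManifold.maximalAtlas 𝓘(ℂ, Fin n → ℂ) ω Ω) {z : Fin n → ℂ} (hz : z ∈ e.target)
    (hz' : e.symm z ∈ e'.source) :
    chartJacobian e z = (fderiv ℂ (e' ∘ e.symm) z).det * chartJacobian e' (e' (e.symm z)) := by
  have hd := differentiableAt_transition he he' hz hz'
  have hev : e.symm =ᶠ[𝓝 z] e'.symm ∘ (e' ∘ e.symm) := by
    have : ∀ᶠ w in 𝓝 z, e.symm w ∈ e'.source :=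
      (e.continuousAt_symm hz).eventually_mem (e'.open_source.mem_nhds hz')
    filter_upwards [this] with w hw
    exact (e'.left_inv hw).symm
  have h1 : mfderiv 𝓘(ℂ, Fin n → ℂ) 𝓘(ℂ, Fin n → ℂ) e.symm z =
      mfderiv 𝓘(ℂ, Fin n → ℂ) 𝓘(ℂ, Fin n → ℂ) (e'.symm ∘ (e' ∘ e.symm)) z := hev.mfderiv_eq
  have h2 := mfderiv_comp z
    ((mdifferentiable_of_mem_maximalAtlas he').mdifferentiableAt_symm (e'.map_source hz'))
    (mdifferentiableAt_iff_differentiableAt.2 hd)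
  rw [mfderiv_eq_fderiv] at h2
  have h3 : chartSymmDeriv e z =
      (chartSymmDeriv e' (e' (e.symm z))).comp (fderiv ℂ (e' ∘ e.symm) z) := h1.trans h2
  rw [chartJacobian, h3, mul_comm]
  exact LinearMap.det_comp _ _

/-- The change of variables formula for the coefficients of a form. -/
theorem chartCoeff_transition {e e' : OpenPartialHomeomorph Ω (Fin n → ℂ)}
    (he : e ∈ IsManifold.maximalAtlas 𝓘(ℂ, Fin n → ℂ) ω Ω)
    (he' : e' ∈ IsManifold.maximalAtlas 𝓘(ℂ, Fin n → ℂ) ω Ω) {z : Fin n → ℂ} (hz : z ∈ e.target)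
    (hz' : e.symm z ∈ e'.source) (α : FormField n Ω E) :
    chartCoeff e α z =
      (fderiv ℂ (e' ∘ e.symm) z).det • chartCoeff e' α (e' (e.symm z)) := by
  rw [chartCoeff_eq, chartCoeff_eq, chartJacobian_transition he he' hz hz', e'.left_inv hz',
    mul_smul]

variable [IsManifold 𝓘(ℂ, Fin n → ℂ) ω Ω]

theorem eq_zero_of_eventually_eq_zero [PreconnectedSpace Ω] {r : Ω → ℂ}
    (hr : ContMDiff 𝓘(ℂ, Fin n → ℂ) 𝓘(ℂ, ℂ) ω r) {p : Ω} (h : ∀ᶠ x in 𝓝 p, r x = 0) : r = 0 := by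
  have := eq_univ_of_mem_nhds_of_analytic (n := n) (Z := {x | r x = 0}) h fun x =>
    ⟨_, analyticOnNhd_comp_symm hr (IsManifold.chart_mem_maximalAtlas x), fun y hy => by
      simp [(chartAt (Fin n → ℂ) x).left_inv hy]⟩
  funext x
  exact this.symm.subset (mem_univ x)

theorem IsAnalyticForm.eq_zero_of_eventually_eq_zero [PreconnectedSpace Ω] {α : FormField n Ω E}
    (hα : IsAnalyticForm α) {p : Ω} (h : ∀ᶠ x in 𝓝 p, covectorCoeff α x = 0) : α = 0 := by
  have := eq_univ_of_mem_nhds_of_analytic (n := n) (Z := {x | covectorCoeff α x = 0}) h fun x =>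
    ⟨_, hα _ (IsManifold.chart_mem_maximalAtlas x), fun y hy => by
      have he := IsManifold.chart_mem_maximalAtlas (I := 𝓘(ℂ, Fin n → ℂ)) (n := ω) x
      rw [chartCoeff_eq_zero_iff he ((chartAt (Fin n → ℂ) x).map_source hy),
        (chartAt (Fin n → ℂ) x).left_inv hy]
      rfl⟩
  exact eq_of_covectorCoeff_eq fun x => this.symm.subset (mem_univ x)

theorem functionOrder_eq_top_iff [PreconnectedSpace Ω] {r : Ω → ℂ}
    (hr : ContMDiff 𝓘(ℂ, Fin n → ℂ) 𝓘(ℂ, ℂ) ω r) {p : Ω} :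
    functionOrder (n := n) p r = ⊤ ↔ r = 0 := by
  set e := chartAt (Fin n → ℂ) p with he
  have hpe : p ∈ e.source := mem_chart_source _ p
  have han := analyticOnNhd_comp_symm hr (IsManifold.chart_mem_maximalAtlas p) (e p)
    (e.map_source hpe)
  rw [functionOrder, orderOfZero_eq_top_iff_eventually han]
  refine ⟨fun h => eq_zero_of_eventually_eq_zero hr (p := p) ?_, fun h => by
    rw [h]; exact Eventually.of_forall fun _ => rfl⟩
  filter_upwards [(e.continuousAt hpe).eventually h, e.open_source.mem_nhds hpe] with x hx hxe
  rw [← e.left_inv hxe]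
  exact hx

theorem formOrder_eq_top_iff [PreconnectedSpace Ω] [CompleteSpace E] {α : FormField n Ω E}
    (hα : IsAnalyticForm α) {p : Ω} : formOrder p α = ⊤ ↔ α = 0 := by
  have hmem := IsManifold.chart_mem_maximalAtlas (I := 𝓘(ℂ, Fin n → ℂ)) (n := ω) p
  set e := chartAt (Fin n → ℂ) p with he
  have hpe : p ∈ e.source := mem_chart_source _ p
  rw [formOrder, orderOfZero_eq_top_iff_eventually (hα e hmem (e p) (e.map_source hpe))]
  refine ⟨fun h => hα.eq_zero_of_eventually_eq_zero (p := p) ?_, fun h => by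
    rw [h]; exact Eventually.of_forall fun _ => rfl⟩
  filter_upwards [(e.continuousAt hpe).eventually h, e.open_source.mem_nhds hpe] with x hx hxe
  have := (chartCoeff_eq_zero_iff hmem (e.map_source hxe)).1 hx
  rwa [e.left_inv hxe] at this

end Manifold

/-! ### Countable covers by charts -/

section Topology

/-- A connected, locally compact, paracompact Hausdorff space is `σ`-compact. -/
theorem sigmaCompactSpace_of_paracompact_connected (X : Type*) [TopologicalSpace X] [T2Space X]
    [ParacompactSpace X] [ConnectedSpace X] [LocallyCompactSpace X] : SigmaCompactSpace X := by
  choose C hC hCn using fun x : X => exists_compact_mem_nhds x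
  obtain ⟨v, hvo, hvU, hvf, hvs⟩ := precise_refinement (fun x => interior (C x))
    (fun x => isOpen_interior) (iUnion_eq_univ_iff.2 fun x => ⟨x, mem_interior_iff_mem_nhds.2 (hCn x)⟩)
  have hcl : ∀ x, IsCompact (closure (v x)) := fun x =>
    (hC x).of_isClosed_subset isClosed_closure
      (closure_minimal ((hvs x).trans interior_subset) (hC x).isClosed)
  let p : X := Classical.arbitrary X
  -- The cover v is locally finite with relatively compact members. A compact set meets only
  -- finitely many of them, so each K k is compact.
  let K : ℕ → Set X := fun k => Nat.rec {p}
    (fun _ L => ⋃ x ∈ {x | (v x ∩ L).Nonempty}, closure (v x)) k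
  have hK : ∀ k, IsCompact (K k) := by
    intro k
    induction k with
    | zero => exact isCompact_singleton
    | succ k ih =>
      exact (hvf.finite_nonempty_inter_compact ih).isCompact_biUnion fun x _ => hcl x
  have hsub : ∀ k x, (v x ∩ K k).Nonempty → v x ⊆ K (k + 1) := fun k x hx =>
    subset_closure.trans (subset_biUnion_of_mem (u := fun x => closure (v x))
      (show x ∈ {x | (v x ∩ K k).Nonempty} from hx))
  -- A member of v that meets the union is contained in it, so the union is both open and closed.
  have hclopen : IsClopen (⋃ k, K k) := by
    constructor
    · refine isClosed_of_closure_subset fun y hy => ?_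
      obtain ⟨x, hx⟩ := iUnion_eq_univ_iff.1 hvU y
      obtain ⟨w, hwv, hw⟩ := mem_closure_iff.1 hy (v x) (hvo x) hx
      obtain ⟨k, hk⟩ := mem_iUnion.1 hw
      exact mem_iUnion.2 ⟨k + 1, hsub k x ⟨w, hwv, hk⟩ hx⟩
    · refine isOpen_iff_mem_nhds.2 fun y hy => ?_
      obtain ⟨k, hk⟩ := mem_iUnion.1 hy
      obtain ⟨x, hx⟩ := iUnion_eq_univ_iff.1 hvU y
      exact mem_of_superset ((hvo x).mem_nhds hx)
        ((hsub k x ⟨y, hx, hk⟩).trans (subset_iUnion K (k + 1)))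
  exact ⟨K, hK, hclopen.eq_univ ⟨p, mem_iUnion.2 ⟨0, rfl⟩⟩⟩

/-- A connected paracompact manifold is covered by countably many charts. -/
theorem exists_countable_chart_cover (H : Type*) [TopologicalSpace H] [LocallyCompactSpace H]
    (X : Type*) [TopologicalSpace X] [T2Space X] [ParacompactSpace X] [ConnectedSpace X]
    [ChartedSpace H X] : ∃ x : ℕ → X, ⋃ i, (chartAt H (x i)).source = univ := by
  have := ChartedSpace.locallyCompactSpace H X
  have := sigmaCompactSpace_of_paracompact_connected X
  obtain ⟨s, hs, hU⟩ := countable_cover_nhds_of_sigmaCompact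
    (f := fun x : X => (chartAt H x).source) fun x => chart_source_mem_nhds H x
  have hne : s.Nonempty := by
    rcases s.eq_empty_or_nonempty with rfl | h
    · rw [biUnion_empty] at hU
      exact absurd hU empty_ne_univ
    · exact h
  obtain ⟨x, rfl⟩ := hs.exists_eq_range hne
  exact ⟨x, by simpa using hU⟩

end Topology

/-! ### The volume measure of a form -/

section Measure

section Chart

variable {n : ℕ} {Ω : Type*} [TopologicalSpace Ω] [MeasurableSpace Ω] [BorelSpace Ω]

theorem measurableSet_target_inter_preimage (e : OpenPartialHomeomorph Ω (Fin n → ℂ)) {s : Set Ω}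
    (hs : MeasurableSet s) : MeasurableSet (e.target ∩ e.symm ⁻¹' s) := by
  have hm : Measurable fun z : e.target => e.symm z :=
    (continuousOn_iff_continuous_domRestrict.1 e.continuousOn_symm).measurable
  have : e.target ∩ e.symm ⁻¹' s = Subtype.val '' ((fun z : e.target => e.symm z) ⁻¹' s) := by
    ext z
    simp [and_comm]
  rw [this]
  exact (MeasurableEmbedding.subtype_coe e.open_target.measurableSet).measurableSet_image.2 (hm hs)

/-- On its target `e.symm` is a measurable embedding, so g may be arbitrary; this matters because
the weight is only a.e. measurable in charts. The condition on ν excludes the arbitrary values of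
`e.symm` off the target. -/
theorem lintegral_map_chart_symm (e : OpenPartialHomeomorph Ω (Fin n → ℂ))
    {ν : Measure (Fin n → ℂ)} (hν : ν.restrict e.target = ν) (g : Ω → ℝ≥0∞) :
    ∫⁻ x, g x ∂(ν.map e.symm) = ∫⁻ z, g (e.symm z) ∂ν := by
  have hemb : MeasurableEmbedding (Subtype.val ∘ e.toHomeomorphSourceTarget.symm) :=
    (MeasurableEmbedding.subtype_coe e.open_source.measurableSet).comp
      e.toHomeomorphSourceTarget.symm.measurableEmbedding
  have hsub := MeasurableEmbedding.subtype_coe e.open_target.measurableSet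
  have h1 : (ν.comap (Subtype.val : e.target → _)).map Subtype.val = ν := by
    rw [map_comap_subtype_coe e.open_target.measurableSet, hν]
  have h2 : AEMeasurable e.symm ((ν.comap (Subtype.val : e.target → _)).map Subtype.val) := by
    rw [h1, ← hν]
    exact e.continuousOn_symm.aemeasurable e.open_target.measurableSet
  have h3 : (e.symm ∘ Subtype.val : e.target → Ω) =
      Subtype.val ∘ e.toHomeomorphSourceTarget.symm := rfl
  conv_lhs => rw [← h1]
  rw [AEMeasurable.map_map_of_aemeasurable h2 measurable_subtype_coe.aemeasurable, h3,
    hemb.lintegral_map]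
  conv_rhs => rw [← h1, hsub.lintegral_map]
  rfl

end Chart

variable {n : ℕ} {Ω : Type*} [TopologicalSpace Ω] [ChartedSpace (Fin n → ℂ) Ω]
  {E : Type*} [NormedAddCommGroup E] [InnerProductSpace ℂ E]

theorem ofReal_density_inChart (S : ConjInvolution E) (e : OpenPartialHomeomorph Ω (Fin n → ℂ))
    (α : FormField n Ω E) (z : Fin n → ℂ) :
    ENNReal.ofReal (S.density (inChart e α z)).re = ‖chartCoeff e α z‖ₑ ^ 2 := by
  rw [S.density_eq, Complex.ofReal_re, ENNReal.ofReal_pow (norm_nonneg _), ofReal_norm]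
  rfl

variable [MeasurableSpace Ω]

theorem chartMeasure_le_formMeasure (S : ConjInvolution E) (α : FormField n Ω E)
    {e : OpenPartialHomeomorph Ω (Fin n → ℂ)}
    (he : e ∈ IsManifold.maximalAtlas 𝓘(ℂ, Fin n → ℂ) ω Ω) :
    chartMeasure S α e ≤ formMeasure S α :=
  le_iSup₂ (f := fun e (_ : e ∈ IsManifold.maximalAtlas 𝓘(ℂ, Fin n → ℂ) ω Ω) =>
    chartMeasure S α e) e he

variable [BorelSpace Ω]

theorem lintegral_chartMeasure (S : ConjInvolution E) {e : OpenPartialHomeomorph Ω (Fin n → ℂ)}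
    (he : e ∈ IsManifold.maximalAtlas 𝓘(ℂ, Fin n → ℂ) ω Ω) {α : FormField n Ω E}
    (hα : IsAnalyticForm α) (g : Ω → ℝ≥0∞) :
    ∫⁻ x, g x ∂(chartMeasure S α e) =
      ∫⁻ z in e.target, ‖chartCoeff e α z‖ₑ ^ 2 * g (e.symm z) := by
  simp only [chartMeasure, ofReal_density_inChart]
  have hm : AEMeasurable (fun z => ‖chartCoeff e α z‖ₑ ^ 2) (volume.restrict e.target) :=
    ((hα e he).continuousOn.enorm.aemeasurable e.open_target.measurableSet).pow_const 2
  rw [lintegral_map_chart_symm, lintegral_withDensity_eq_lintegral_mul_non_measurable₀ _ hm]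
  · rfl
  · exact Eventually.of_forall fun z => ENNReal.pow_lt_top enorm_lt_top
  · rw [restrict_withDensity e.open_target.measurableSet, Measure.restrict_restrict
      e.open_target.measurableSet, inter_self]

theorem setLIntegral_chartMeasure (S : ConjInvolution E)
    {e : OpenPartialHomeomorph Ω (Fin n → ℂ)}
    (he : e ∈ IsManifold.maximalAtlas 𝓘(ℂ, Fin n → ℂ) ω Ω) {α : FormField n Ω E}
    (hα : IsAnalyticForm α) {s : Set Ω} (hs : MeasurableSet s) (g : Ω → ℝ≥0∞) :
    ∫⁻ x in s, g x ∂(chartMeasure S α e) =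
      ∫⁻ z in e.target ∩ e.symm ⁻¹' s, ‖chartCoeff e α z‖ₑ ^ 2 * g (e.symm z) := by
  rw [← lintegral_indicator hs, lintegral_chartMeasure S he hα,
    ← lintegral_indicator (measurableSet_target_inter_preimage e hs),
    ← lintegral_indicator e.open_target.measurableSet]
  refine lintegral_congr fun z => ?_
  by_cases h1 : z ∈ e.target <;> by_cases h2 : e.symm z ∈ s <;> simp [h1, h2]

theorem chartMeasure_apply (S : ConjInvolution E) {e : OpenPartialHomeomorph Ω (Fin n → ℂ)}
    (he : e ∈ IsManifold.maximalAtlas 𝓘(ℂ, Fin n → ℂ) ω Ω) {α : FormField n Ω E}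
    (hα : IsAnalyticForm α) {s : Set Ω} (hs : MeasurableSet s) :
    chartMeasure S α e s = ∫⁻ z in e.target ∩ e.symm ⁻¹' s, ‖chartCoeff e α z‖ₑ ^ 2 := by
  have := setLIntegral_chartMeasure S he hα hs 1
  simpa using this

/-- The real determinant of a complex linear map is the norm from ℂ to ℝ of its complex determinant.
-/
theorem ofReal_abs_det_restrictScalars (A : (Fin n → ℂ) →L[ℂ] (Fin n → ℂ)) :
    ENNReal.ofReal |(A.restrictScalars ℝ).det| = ‖A.det‖ₑ ^ 2 := by
  have h : (A.restrictScalars ℝ).det = ‖A.det‖ ^ 2 := by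
    have := LinearMap.det_restrictScalars (R := ℝ) (f := (A : (Fin n → ℂ) →ₗ[ℂ] (Fin n → ℂ)))
    rw [Algebra.norm_complex_apply, Complex.normSq_eq_norm_sq] at this
    exact this
  rw [h, abs_of_nonneg (by positivity), ENNReal.ofReal_pow (norm_nonneg _), ofReal_norm]

/-- The measures defined by a form in two local coordinates agree on the common domain. -/
theorem chartMeasure_congr (S : ConjInvolution E) {e e' : OpenPartialHomeomorph Ω (Fin n → ℂ)}
    (he : e ∈ IsManifold.maximalAtlas 𝓘(ℂ, Fin n → ℂ) ω Ω)
    (he' : e' ∈ IsManifold.maximalAtlas 𝓘(ℂ, Fin n → ℂ) ω Ω) {α : FormField n Ω E}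
    (hα : IsAnalyticForm α) {s : Set Ω} (hs : MeasurableSet s) (hse : s ⊆ e.source)
    (hse' : s ⊆ e'.source) : chartMeasure S α e s = chartMeasure S α e' s := by
  rw [chartMeasure_apply S he hα hs, chartMeasure_apply S he' hα hs]
  set A := e.target ∩ e.symm ⁻¹' s
  have himg : e'.target ∩ e'.symm ⁻¹' s = (e' ∘ e.symm) '' A := by
    ext w
    constructor
    · rintro ⟨hw, hws⟩
      refine ⟨e (e'.symm w), ⟨e.map_source (hse hws), ?_⟩, ?_⟩
      · simpa [e.left_inv (hse hws)] using hws
      · simp [e.left_inv (hse hws), e'.right_inv hw]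
    · rintro ⟨z, ⟨hz, hzs⟩, rfl⟩
      refine ⟨e'.map_source (hse' hzs), ?_⟩
      simpa [e'.left_inv (hse' hzs)] using hzs
  have hinj : InjOn (e' ∘ e.symm) A := e'.injOn.comp (e.symm.injOn.mono fun z hz => hz.1)
    fun z hz => hse' hz.2
  have hd : ∀ z ∈ A, HasFDerivWithinAt (e' ∘ e.symm)
      ((fderiv ℂ (e' ∘ e.symm) z).restrictScalars ℝ) A z := fun z hz =>
    ((differentiableAt_transition he he' hz.1 (hse' hz.2)).hasFDerivAt.restrictScalars
      ℝ).hasFDerivWithinAt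
  have hA : MeasurableSet A := measurableSet_target_inter_preimage e hs
  -- The real Jacobian produced by the change of variables is the squared modulus of the complex
  -- one, which is the factor relating the two coefficients squared.
  rw [himg, lintegral_image_eq_lintegral_abs_det_fderiv_mul volume hA hd hinj]
  refine setLIntegral_congr_fun hA fun z hz => ?_
  rw [ofReal_abs_det_restrictScalars, chartCoeff_transition he he' hz.1 (hse' hz.2), enorm_smul,
    mul_pow]
  rfl

/-- The squared norm of a form in a weighted Bergman space locally bounds its coefficients. -/
theorem exists_enorm_sq_chartCoeff_le [CompleteSpace E] (S : ConjInvolution E) {k : Ω → ℝ}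
    (hk : IsAdmissibleWeight n k) {e : OpenPartialHomeomorph Ω (Fin n → ℂ)}
    (he : e ∈ IsManifold.maximalAtlas 𝓘(ℂ, Fin n → ℂ) ω Ω) {z₀ : Fin n → ℂ} (hz₀ : z₀ ∈ e.target) :
    ∃ ρ > 0, Metric.ball z₀ ρ ⊆ e.target ∧ ∃ C : ℝ≥0, ∀ α : FormField n Ω E, IsAnalyticForm α →
      ∀ z ∈ Metric.ball z₀ ρ, ‖chartCoeff e α z‖ₑ ^ 2 ≤ C * weightedNormSq S k α := by
  -- The lower bound of k is available in e', whereas the estimate concerns e. They are linked on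
  -- the set V below, where the two chart measures agree.
  obtain ⟨e', he', hae', -, ε, hε, hbound⟩ := hk.bounded_below (e.symm z₀)
  have hopen : IsOpen (e.target ∩ e.symm ⁻¹' e'.source) :=
    e.symm.isOpen_inter_preimage e'.open_source
  obtain ⟨ρ, hρ, hball⟩ := Metric.isOpen_iff.1 hopen z₀ ⟨hz₀, hae'⟩
  have hρ2 : 0 < ρ / 2 := by positivity
  set V := e.source ∩ e ⁻¹' Metric.ball z₀ ρ with hV
  have hVo : IsOpen V := e.isOpen_inter_preimage Metric.isOpen_ball
  have hVe' : V ⊆ e'.source := fun x hx => by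
    have := (hball hx.2).2
    rwa [mem_preimage, e.left_inv hx.1] at this
  have hVball : e.target ∩ e.symm ⁻¹' V = Metric.ball z₀ ρ := by
    ext w
    constructor
    · rintro ⟨hw, -, hb⟩
      rwa [mem_preimage, e.right_inv hw] at hb
    · intro hw
      have hwt := (hball hw).1
      exact ⟨hwt, e.map_target hwt, by rwa [mem_preimage, e.right_inv hwt]⟩
  set v := volume (Metric.ball z₀ (ρ / 2))
  have hv0 : v ≠ 0 := (Metric.measure_ball_pos _ _ hρ2).ne'
  have hv1 : v ≠ ⊤ := measure_ball_lt_top.ne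
  have hε' : ENNReal.ofReal ε ≠ 0 := by simpa using hε
  -- Halving the radius keeps the ball of radius ρ/2 around each z inside the ball of radius ρ
  -- around z₀. The constant is the product of 1/v, from the mean value inequality, and 1/ε, from
  -- the weight.
  refine ⟨ρ / 2, hρ2, fun z hz => (hball (Metric.ball_subset_ball (by linarith) hz)).1,
    (v⁻¹ * (ENNReal.ofReal ε)⁻¹).toNNReal, fun α hα z hz => ?_⟩
  rw [ENNReal.coe_toNNReal (ENNReal.mul_ne_top (ENNReal.inv_ne_top.2 hv0)
    (ENNReal.inv_ne_top.2 hε'))]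
  have hzρ : Metric.ball z (ρ / 2) ⊆ Metric.ball z₀ ρ := by
    refine Metric.ball_subset_ball' ?_
    rw [Metric.mem_ball] at hz
    linarith
  have h1 := enorm_sq_mul_volume_le_lintegral hρ2
    ((hα e he).mono (hzρ.trans fun w hw => (hball hw).1))
  rw [Measure.addHaar_ball_center, ← Measure.addHaar_ball_center volume z₀] at h1
  have h2 : ∫⁻ w in Metric.ball z (ρ / 2), ‖chartCoeff e α w‖ₑ ^ 2 ≤ chartMeasure S α e' V := by
    rw [← chartMeasure_congr S he he' hα hVo.measurableSet inter_subset_left hVe',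
      chartMeasure_apply S he hα hVo.measurableSet, hVball]
    exact lintegral_mono_set hzρ
  have h3 : ENNReal.ofReal ε * chartMeasure S α e' V ≤ weightedNormSq S k α := by
    have hmeas := measurableSet_target_inter_preimage e' hVo.measurableSet
    calc ENNReal.ofReal ε * chartMeasure S α e' V
        = ∫⁻ z in e'.target ∩ e'.symm ⁻¹' V, ENNReal.ofReal ε * ‖chartCoeff e' α z‖ₑ ^ 2 := by
          rw [chartMeasure_apply S he' hα hVo.measurableSet,
            lintegral_const_mul' _ _ ENNReal.ofReal_ne_top]
      _ ≤ ∫⁻ z in e'.target ∩ e'.symm ⁻¹' V,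
            ‖chartCoeff e' α z‖ₑ ^ 2 * ENNReal.ofReal (k (e'.symm z)) := by
          refine lintegral_mono_ae ?_
          filter_upwards [ae_restrict_of_ae_restrict_of_subset inter_subset_left hbound] with z hz
          rw [mul_comm]
          gcongr
      _ = ∫⁻ x in V, ENNReal.ofReal (k x) ∂(chartMeasure S α e') :=
          (setLIntegral_chartMeasure S he' hα hVo.measurableSet
            fun x => ENNReal.ofReal (k x)).symm
      _ ≤ ∫⁻ x, ENNReal.ofReal (k x) ∂(chartMeasure S α e') := setLIntegral_le_lintegral _ _
      _ ≤ weightedNormSq S k α := lintegral_mono' (chartMeasure_le_formMeasure S α he') le_rfl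
  calc ‖chartCoeff e α z‖ₑ ^ 2 ≤ weightedNormSq S k α / ENNReal.ofReal ε / v := by
        rw [ENNReal.le_div_iff_mul_le (Or.inl hv0) (Or.inl hv1)]
        refine (h1.trans h2).trans ?_
        rw [ENNReal.le_div_iff_mul_le (Or.inl hε') (Or.inl ENNReal.ofReal_ne_top), mul_comm]
        exact h3
    _ = _ := by rw [div_eq_mul_inv, div_eq_mul_inv]; ring

/-- The form measure as a sum over a countable measurable partition subordinate to charts. -/
theorem formMeasure_eq_sum (S : ConjInvolution E) {e : ℕ → OpenPartialHomeomorph Ω (Fin n → ℂ)}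
    (he : ∀ i, e i ∈ IsManifold.maximalAtlas 𝓘(ℂ, Fin n → ℂ) ω Ω) {A : ℕ → Set Ω}
    (hA : ∀ i, MeasurableSet (A i)) (hAe : ∀ i, A i ⊆ (e i).source)
    (hdisj : Pairwise (Function.onFun Disjoint A)) (hU : ⋃ i, A i = univ) {α : FormField n Ω E}
    (hα : IsAnalyticForm α) :
    formMeasure S α = Measure.sum fun i => (chartMeasure S α (e i)).restrict (A i) := by
  have hsplit : ∀ (μ : Measure Ω) {s : Set Ω}, MeasurableSet s → μ s = ∑' i, μ (s ∩ A i) := by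
    intro μ s hs
    rw [← measure_iUnion (fun i j hij => (hdisj hij).mono inter_subset_right inter_subset_right)
      fun i => hs.inter (hA i), ← inter_iUnion, hU, inter_univ]
  -- Inside the part A i every chart measure agrees with that of e i on the common domain, which
  -- bounds the supremum by the sum. The converse holds since each chart measure is below the
  -- supremum.
  refine le_antisymm (iSup₂_le fun e' he' => Measure.le_iff.2 fun s hs => ?_)
    (Measure.le_iff.2 fun s hs => ?_)
  · have h0 : chartMeasure S α e' s = chartMeasure S α e' (s ∩ e'.source) := by
      rw [chartMeasure_apply S he' hα hs,
        chartMeasure_apply S he' hα (hs.inter e'.open_source.measurableSet)]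
      congr 2
      ext z
      simp only [mem_inter_iff, mem_preimage]
      exact ⟨fun h => ⟨h.1, h.2, e'.map_target h.1⟩, fun h => ⟨h.1, h.2.1⟩⟩
    have hm := hs.inter e'.open_source.measurableSet
    rw [h0, hsplit _ hm, Measure.sum_apply _ hs]
    refine ENNReal.tsum_le_tsum fun i => ?_
    rw [chartMeasure_congr S he' (he i) hα (hm.inter (hA i))
      (fun x hx => hx.1.2) (fun x hx => hAe i hx.2), Measure.restrict_apply hs]
    exact measure_mono fun x hx => ⟨hx.1.1, hx.2⟩
  · rw [hsplit (formMeasure S α) hs, Measure.sum_apply _ hs]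
    refine ENNReal.tsum_le_tsum fun i => ?_
    rw [Measure.restrict_apply hs]
    exact chartMeasure_le_formMeasure S α (he i) _

theorem weightedNormSq_eq_tsum (S : ConjInvolution E) (k : Ω → ℝ)
    {e : ℕ → OpenPartialHomeomorph Ω (Fin n → ℂ)}
    (he : ∀ i, e i ∈ IsManifold.maximalAtlas 𝓘(ℂ, Fin n → ℂ) ω Ω) {A : ℕ → Set Ω}
    (hA : ∀ i, MeasurableSet (A i)) (hAe : ∀ i, A i ⊆ (e i).source)
    (hdisj : Pairwise (Function.onFun Disjoint A)) (hU : ⋃ i, A i = univ) {α : FormField n Ω E}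
    (hα : IsAnalyticForm α) :
    weightedNormSq S k α = ∑' i, ∫⁻ z in (e i).target ∩ (e i).symm ⁻¹' A i,
      ‖chartCoeff (e i) α z‖ₑ ^ 2 * ENNReal.ofReal (k ((e i).symm z)) := by
  rw [weightedNormSq, formMeasure_eq_sum S he hA hAe hdisj hU hα, lintegral_sum_measure]
  exact tsum_congr fun i => setLIntegral_chartMeasure S (he i) hα (hA i) _

end Measure

/-- A countable measurable partition of a complex manifold, each part of which lies in the domain of
a chart. -/
structure ChartPartition (n : ℕ) (Ω : Type*) [TopologicalSpace Ω] [ChartedSpace (Fin n → ℂ) Ω]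
    [MeasurableSpace Ω] where
  chart : ℕ → OpenPartialHomeomorph Ω (Fin n → ℂ)
  part : ℕ → Set Ω
  chart_mem : ∀ i, chart i ∈ IsManifold.maximalAtlas 𝓘(ℂ, Fin n → ℂ) ω Ω
  measurableSet_part : ∀ i, MeasurableSet (part i)
  part_subset : ∀ i, part i ⊆ (chart i).source
  disjoint : Pairwise (Function.onFun Disjoint part)
  iUnion_part : ⋃ i, part i = univ

theorem ChartPartition.nonempty (n : ℕ) (Ω : Type*) [TopologicalSpace Ω] [T2Space Ω]
    [ParacompactSpace Ω] [ConnectedSpace Ω] [ChartedSpace (Fin n → ℂ) Ω]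
    [IsManifold 𝓘(ℂ, Fin n → ℂ) ω Ω] [MeasurableSpace Ω] [BorelSpace Ω] :
    Nonempty (ChartPartition n Ω) := by
  obtain ⟨x, hx⟩ := exists_countable_chart_cover (Fin n → ℂ) Ω
  exact ⟨{
    chart := fun i => chartAt (Fin n → ℂ) (x i)
    part := disjointed fun i => (chartAt (Fin n → ℂ) (x i)).source
    chart_mem := fun i => IsManifold.chart_mem_maximalAtlas (x i)
    measurableSet_part := fun i => MeasurableSet.disjointed
      (fun i => (chartAt (Fin n → ℂ) (x i)).open_source.measurableSet) i
    part_subset := fun i => disjointed_subset _ i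
    disjoint := disjoint_disjointed _
    iUnion_part := by rw [iUnion_disjointed, hx] }⟩

/-! ### The isometric embedding in an L² space -/

namespace ChartPartition

variable {n : ℕ} {Ω : Type*} [TopologicalSpace Ω] [ChartedSpace (Fin n → ℂ) Ω]
  [MeasurableSpace Ω] {E : Type*} [NormedAddCommGroup E] [InnerProductSpace ℂ E]

/-- The image of the `i`-th part in the coordinates of the `i`-th chart. -/
def image (P : ChartPartition n Ω) (i : ℕ) : Set (Fin n → ℂ) :=
  (P.chart i).target ∩ (P.chart i).symm ⁻¹' P.part i

/-- Lebesgue measure with density `k` on the disjoint union of the coordinate images of the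
parts. -/
noncomputable def weightMeasure (P : ChartPartition n Ω) (k : Ω → ℝ) :
    Measure (ℕ × (Fin n → ℂ)) :=
  Measure.sum fun i => ((volume.restrict (P.image i)).withDensity fun z =>
    ENNReal.ofReal (k ((P.chart i).symm z))).map (Prod.mk i)

/-- The coefficient function of a form on the disjoint union of the coordinate images. -/
noncomputable def coeff (P : ChartPartition n Ω) (α : FormField n Ω E) (q : ℕ × (Fin n → ℂ)) : E :=
  chartCoeff (P.chart q.1) α q.2

theorem aemeasurable_weight (P : ChartPartition n Ω) {k : Ω → ℝ} (hk : IsAdmissibleWeight n k)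
    (i : ℕ) : AEMeasurable (fun z => ENNReal.ofReal (k ((P.chart i).symm z)))
      (volume.restrict (P.image i)) :=
  ((hk.measurable _ (P.chart_mem i)).ennreal_ofReal).mono_measure
    (Measure.restrict_mono inter_subset_left le_rfl)

theorem lintegral_weightMeasure (P : ChartPartition n Ω) {k : Ω → ℝ}
    (hk : IsAdmissibleWeight n k) (g : ℕ × (Fin n → ℂ) → ℝ≥0∞) :
    ∫⁻ q, g q ∂(P.weightMeasure k) =
      ∑' i, ∫⁻ z in P.image i, g (i, z) * ENNReal.ofReal (k ((P.chart i).symm z)) := by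
  rw [weightMeasure, lintegral_sum_measure]
  refine tsum_congr fun i => ?_
  rw [(measurableEmbedding_prodMk_left i).lintegral_map,
    lintegral_withDensity_eq_lintegral_mul_non_measurable₀ _ (P.aemeasurable_weight hk i)
      (Eventually.of_forall fun _ => ENNReal.ofReal_lt_top)]
  exact lintegral_congr fun z => mul_comm _ _

variable [BorelSpace Ω]

theorem measurableSet_image (P : ChartPartition n Ω) (i : ℕ) : MeasurableSet (P.image i) :=
  measurableSet_target_inter_preimage _ (P.measurableSet_part i)

theorem aestronglyMeasurable_coeff (P : ChartPartition n Ω) (k : Ω → ℝ) {α : FormField n Ω E}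
    (hα : IsAnalyticForm α) : AEStronglyMeasurable (P.coeff α) (P.weightMeasure k) := by
  refine aestronglyMeasurable_sum_measure_iff.2 fun i => ?_
  rw [(measurableEmbedding_prodMk_left i).aestronglyMeasurable_map_iff]
  refine AEStronglyMeasurable.mono_ac (withDensity_absolutelyContinuous _ _) ?_
  exact ((hα _ (P.chart_mem i)).continuousOn.mono inter_subset_left).aestronglyMeasurable
    (P.measurableSet_image i)

/-- Both sides are the same sum over the parts. The Bergman norm is thus an L² norm, and so comes
from an inner product. -/
theorem eLpNorm_coeff (P : ChartPartition n Ω) (S : ConjInvolution E) {k : Ω → ℝ}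
    (hk : IsAdmissibleWeight n k) {α : FormField n Ω E} (hα : IsAnalyticForm α) :
    eLpNorm (P.coeff α) 2 (P.weightMeasure k) ^ 2 = weightedNormSq S k α := by
  have h := eLpNorm_nnreal_pow_eq_lintegral (μ := P.weightMeasure k) (f := P.coeff α) (p := 2)
    two_ne_zero
  simp only [NNReal.coe_ofNat, ENNReal.rpow_ofNat, ENNReal.coe_ofNat] at h
  rw [h, P.lintegral_weightMeasure hk, weightedNormSq_eq_tsum S k P.chart_mem P.measurableSet_part
    P.part_subset P.disjoint P.iUnion_part hα]
  rfl

theorem memLp_coeff_iff (P : ChartPartition n Ω) (S : ConjInvolution E) {k : Ω → ℝ}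
    (hk : IsAdmissibleWeight n k) {α : FormField n Ω E} (hα : IsAnalyticForm α) :
    MemLp (P.coeff α) 2 (P.weightMeasure k) ↔ weightedNormSq S k α < ⊤ := by
  rw [MemLp, and_iff_right (P.aestronglyMeasurable_coeff k hα), ← P.eLpNorm_coeff S hk hα,
    ENNReal.pow_lt_top_iff]
  simp

/-- The embedding of a weighted Bergman space in an `L²` space. -/
noncomputable def toL2 (P : ChartPartition n Ω) (S : ConjInvolution E) {k : Ω → ℝ}
    (hk : IsAdmissibleWeight n k) :
    bergmanSpace (n := n) S k →ₗ[ℂ] Lp E 2 (P.weightMeasure k) where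
  toFun α := ((P.memLp_coeff_iff S hk α.2.1).2 α.2.2).toLp (P.coeff (α : FormField n Ω E))
  map_add' _ _ := rfl
  map_smul' _ _ := rfl

theorem norm_toL2_sq (P : ChartPartition n Ω) (S : ConjInvolution E) {k : Ω → ℝ}
    (hk : IsAdmissibleWeight n k) (α : bergmanSpace (n := n) S k) :
    ‖P.toL2 S hk α‖ ^ 2 = (weightedNormSq S k (α : FormField n Ω E)).toReal := by
  have : ‖P.toL2 S hk α‖ = (eLpNorm (P.coeff (α : FormField n Ω E)) 2 (P.weightMeasure k)).toReal :=
    Lp.norm_toLp _ ((P.memLp_coeff_iff S hk α.2.1).2 α.2.2)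
  rw [this, ← ENNReal.toReal_pow, P.eLpNorm_coeff S hk α.2.1]

end ChartPartition

/-! ### Bounds for coefficients and their derivatives -/

section Estimates

variable {n : ℕ} {Ω : Type*} [TopologicalSpace Ω] [ChartedSpace (Fin n → ℂ) Ω]
  [MeasurableSpace Ω] [BorelSpace Ω]
  {E : Type*} [NormedAddCommGroup E] [InnerProductSpace ℂ E] [CompleteSpace E]

theorem exists_norm_chartCoeff_le (S : ConjInvolution E) {k : Ω → ℝ}
    (hk : IsAdmissibleWeight n k) {e : OpenPartialHomeomorph Ω (Fin n → ℂ)}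
    (he : e ∈ IsManifold.maximalAtlas 𝓘(ℂ, Fin n → ℂ) ω Ω) {z₀ : Fin n → ℂ} (hz₀ : z₀ ∈ e.target) :
    ∃ ρ > 0, Metric.ball z₀ ρ ⊆ e.target ∧ ∃ C : ℝ, 0 < C ∧
      ∀ α ∈ bergmanSpace (n := n) S k, ∀ z ∈ Metric.ball z₀ ρ,
        ‖chartCoeff e α z‖ ≤ C * √(weightedNormSq S k α).toReal := by
  obtain ⟨ρ, hρ, hb, C, hC⟩ := exists_enorm_sq_chartCoeff_le S hk he hz₀
  -- The summand 1 only ensures that the constant is positive, so that it can later be divided by.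
  refine ⟨ρ, hρ, hb, √C + 1, by positivity, fun α hα z hz => ?_⟩
  have h1 := ENNReal.toReal_mono (ENNReal.mul_ne_top ENNReal.coe_ne_top hα.2.ne) (hC α hα.1 z hz)
  rw [ENNReal.toReal_pow, toReal_enorm, ENNReal.toReal_mul, ENNReal.coe_toReal] at h1
  have h2 := Real.le_sqrt_of_sq_le h1
  rw [Real.sqrt_mul (NNReal.coe_nonneg C)] at h2
  refine h2.trans ?_
  gcongr
  linarith

theorem exists_norm_chartCoeff_le_of_isCompact (S : ConjInvolution E) {k : Ω → ℝ}
    (hk : IsAdmissibleWeight n k) {e : OpenPartialHomeomorph Ω (Fin n → ℂ)}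
    (he : e ∈ IsManifold.maximalAtlas 𝓘(ℂ, Fin n → ℂ) ω Ω) {K : Set (Fin n → ℂ)}
    (hKe : K ⊆ e.target) (hK : IsCompact K) :
    ∃ C : ℝ, 0 < C ∧ ∀ α ∈ bergmanSpace (n := n) S k, ∀ z ∈ K,
      ‖chartCoeff e α z‖ ≤ C * √(weightedNormSq S k α).toReal := by
  refine hK.induction_on (p := fun K => ∃ C : ℝ, 0 < C ∧ ∀ α ∈ bergmanSpace (n := n) S k, ∀ z ∈ K,
    ‖chartCoeff e α z‖ ≤ C * √(weightedNormSq S k α).toReal) ⟨1, one_pos, by simp⟩ ?_ ?_ ?_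
  · rintro s t hst ⟨C, hC, h⟩
    exact ⟨C, hC, fun α hα z hz => h α hα z (hst hz)⟩
  · rintro s t ⟨C, hC, h⟩ ⟨D, hD, h'⟩
    refine ⟨max C D, lt_max_of_lt_left hC, fun α hα z hz => ?_⟩
    rcases hz with hz | hz
    · exact (h α hα z hz).trans (by gcongr; exact le_max_left _ _)
    · exact (h' α hα z hz).trans (by gcongr; exact le_max_right _ _)
  · intro z hz
    obtain ⟨ρ, hρ, -, C, hC, h⟩ := exists_norm_chartCoeff_le S hk he (hKe hz)
    exact ⟨_, mem_nhdsWithin_of_mem_nhds (Metric.ball_mem_nhds z hρ), C, hC, h⟩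

/-- The derivatives of the coefficients at a point are bounded in terms of the norm. -/
theorem exists_norm_iteratedFDeriv_chartCoeff_le (S : ConjInvolution E) {k : Ω → ℝ}
    (hk : IsAdmissibleWeight n k) {e : OpenPartialHomeomorph Ω (Fin n → ℂ)}
    (he : e ∈ IsManifold.maximalAtlas 𝓘(ℂ, Fin n → ℂ) ω Ω) {z : Fin n → ℂ} (hz : z ∈ e.target)
    (m : ℕ) : ∃ C : ℝ, 0 < C ∧ ∀ α ∈ bergmanSpace (n := n) S k,
      ‖iteratedFDeriv ℂ m (chartCoeff e α) z‖ ≤ C * √(weightedNormSq S k α).toReal := by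
  obtain ⟨ρ, hρ, hb, C, hC, h⟩ := exists_norm_chartCoeff_le S hk he hz
  refine ⟨C / (ρ / (m + 1)) ^ m, by positivity, fun α hα => ?_⟩
  refine (norm_iteratedFDeriv_center_le hρ ((hα.1 e he).mono hb) (by positivity)
    (h α hα) m).trans (le_of_eq ?_)
  ring

end Estimates

/-! ### Completeness -/

section Complete

variable {n : ℕ} {Ω : Type*} [TopologicalSpace Ω] [ChartedSpace (Fin n → ℂ) Ω]
  [MeasurableSpace Ω] [BorelSpace Ω]
  {E : Type*} [NormedAddCommGroup E] [InnerProductSpace ℂ E]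

theorem ChartPartition.sqrt_weightedNormSq (P : ChartPartition n Ω) (S : ConjInvolution E)
    {k : Ω → ℝ} (hk : IsAdmissibleWeight n k) (α : bergmanSpace (n := n) S k) :
    √(weightedNormSq S k (α : FormField n Ω E)).toReal = ‖P.toL2 S hk α‖ := by
  rw [← P.norm_toL2_sq, Real.sqrt_sq (norm_nonneg _)]

variable [IsManifold 𝓘(ℂ, Fin n → ℂ) ω Ω] [CompleteSpace E]

theorem exists_norm_covectorCoeff_le (S : ConjInvolution E) {k : Ω → ℝ}
    (hk : IsAdmissibleWeight n k) (x : Ω) :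
    ∃ C : ℝ, 0 < C ∧ ∀ α ∈ bergmanSpace (n := n) S k,
      ‖covectorCoeff α x‖ ≤ C * √(weightedNormSq S k α).toReal := by
  have he := IsManifold.chart_mem_maximalAtlas (I := 𝓘(ℂ, Fin n → ℂ)) (n := ω) x
  set e := chartAt (Fin n → ℂ) x
  have hx : x ∈ e.source := mem_chart_source _ x
  obtain ⟨ρ, hρ, -, C, hC, h⟩ := exists_norm_chartCoeff_le S hk he (e.map_source hx)
  have hJ := chartJacobian_ne_zero he (e.map_source hx)
  refine ⟨‖(chartJacobian e (e x))⁻¹‖ * C, mul_pos (norm_pos_iff.2 (inv_ne_zero hJ)) hC,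
    fun α hα => ?_⟩
  rw [covectorCoeff_eq he hx, norm_smul, mul_assoc]
  gcongr
  exact h α hα _ (Metric.mem_ball_self hρ)

/-- Evaluation at each point is bounded by the norm, so a form of norm 0 vanishes everywhere. -/
theorem ChartPartition.toL2_injective (P : ChartPartition n Ω) (S : ConjInvolution E)
    {k : Ω → ℝ} (hk : IsAdmissibleWeight n k) : Function.Injective (P.toL2 S hk) := by
  refine (injective_iff_map_eq_zero _).2 fun α hα => ?_
  refine Subtype.ext (eq_of_covectorCoeff_eq fun x => ?_)
  obtain ⟨C, -, h⟩ := exists_norm_covectorCoeff_le S hk x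
  have := h _ α.2
  rw [P.sqrt_weightedNormSq S hk, hα, norm_zero, mul_zero, norm_le_zero_iff] at this
  rw [this]
  rfl

/-- The limit of a Cauchy sequence of analytic forms in the Bergman norm. -/
theorem ChartPartition.exists_isAnalyticForm_limit (P : ChartPartition n Ω) (S : ConjInvolution E)
    {k : Ω → ℝ} (hk : IsAdmissibleWeight n k) {α : ℕ → bergmanSpace (n := n) S k}
    (hα : CauchySeq fun j => P.toL2 S hk (α j)) :
    ∃ β : FormField n Ω E, IsAnalyticForm β ∧
      ∀ e ∈ IsManifold.maximalAtlas 𝓘(ℂ, Fin n → ℂ) ω Ω, ∀ z,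
        Tendsto (fun j => chartCoeff e (α j : FormField n Ω E) z) atTop (𝓝 (chartCoeff e β z)) := by
  have hnorm : ∀ i j, √(weightedNormSq S k (α i - α j : FormField n Ω E)).toReal =
      dist (P.toL2 S hk (α i)) (P.toL2 S hk (α j)) := fun i j => by
    rw [dist_eq_norm, ← map_sub, ← P.sqrt_weightedNormSq S hk]
    rfl
  -- The pointwise limit is taken in the model tangent spaces, so that a single limit form serves
  -- all charts.
  have hcoeff : ∀ x, ∃ u : E, Tendsto (fun j => covectorCoeff (α j : FormField n Ω E) x) atTop
      (𝓝 u) := by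
    intro x
    refine cauchySeq_tendsto_of_complete (Metric.cauchySeq_iff.2 fun ε hε => ?_)
    obtain ⟨C, hC, h⟩ := exists_norm_covectorCoeff_le S hk x
    obtain ⟨N, hN⟩ := Metric.cauchySeq_iff.1 hα (ε / C) (by positivity)
    refine ⟨N, fun i hi j hj => ?_⟩
    have h1 := h _ (α i - α j).2
    have h2 := hN i hi j hj
    rw [lt_div_iff₀ hC, mul_comm, ← hnorm] at h2
    rw [dist_eq_norm]
    exact h1.trans_lt h2
  choose u hu using hcoeff
  have hlim : ∀ e ∈ IsManifold.maximalAtlas 𝓘(ℂ, Fin n → ℂ) ω Ω, ∀ z,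
      Tendsto (fun j => chartCoeff e (α j : FormField n Ω E) z) atTop
        (𝓝 (chartCoeff e (formOfCoeff u) z)) := by
    intro e _ z
    simp only [chartCoeff_eq, covectorCoeff_formOfCoeff]
    exact (hu _).const_smul _
  refine ⟨formOfCoeff u, fun e he z hz => ?_, hlim⟩
  obtain ⟨ρ, hρ, hb, C, hC, h⟩ := exists_norm_chartCoeff_le S hk he hz
  refine analyticAt_of_uniformCauchySeqOn hρ (fun j => ((α j).2.1 e he).mono hb) ?_
    fun w _ => hlim e he w
  refine Metric.uniformCauchySeqOn_iff.2 fun ε hε => ?_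
  obtain ⟨N, hN⟩ := Metric.cauchySeq_iff.1 hα (ε / C) (by positivity)
  refine ⟨N, fun i hi j hj w hw => ?_⟩
  have h1 := h _ (α i - α j).2 w hw
  have h2 := hN i hi j hj
  rw [lt_div_iff₀ hC, mul_comm, ← hnorm] at h2
  rw [dist_eq_norm]
  exact h1.trans_lt h2

/-- An L² limit is an a.e. limit along a subsequence, so it agrees a.e. with the coefficients of the
pointwise limit form, which is analytic. That form has finite norm because the L² limit has. -/
theorem ChartPartition.isClosed_range_toL2 (P : ChartPartition n Ω) (S : ConjInvolution E)
    {k : Ω → ℝ} (hk : IsAdmissibleWeight n k) : IsClosed (range (P.toL2 S hk)) := by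
  refine IsSeqClosed.isClosed fun a G ha hG => ?_
  choose α hα using ha
  obtain rfl : (fun j => P.toL2 S hk (α j)) = a := funext hα
  obtain ⟨β, hβ, hlim⟩ := P.exists_isAnalyticForm_limit S hk hG.cauchySeq
  obtain ⟨ns, hns, hae⟩ := (tendstoInMeasure_of_tendsto_Lp hG).exists_seq_tendsto_ae
  have hae2 : ∀ᵐ q ∂(P.weightMeasure k), ∀ j,
      P.toL2 S hk (α j) q = P.coeff (α j : FormField n Ω E) q :=
    ae_all_iff.2 fun j => MemLp.coeFn_toLp ((P.memLp_coeff_iff S hk (α j).2.1).2 (α j).2.2)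
  have hG' : G =ᵐ[P.weightMeasure k] P.coeff β := by
    filter_upwards [hae, hae2] with q h1 h2
    simp only [h2] at h1
    exact tendsto_nhds_unique h1 ((hlim _ (P.chart_mem q.1) q.2).comp hns.tendsto_atTop)
  have hmem : MemLp (P.coeff β) 2 (P.weightMeasure k) := (memLp_congr_ae hG').1 (Lp.memLp G)
  refine ⟨⟨β, hβ, (P.memLp_coeff_iff S hk hβ).1 hmem⟩, ?_⟩
  refine Lp.ext ((MemLp.coeFn_toLp hmem).trans hG'.symm)

end Complete

/-! ### Multiplication by bounded analytic functions -/

section PointwiseMultiplication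

variable {n : ℕ} {Ω : Type*} [TopologicalSpace Ω] [ChartedSpace (Fin n → ℂ) Ω]
  {E : Type*} [NormedAddCommGroup E] [InnerProductSpace ℂ E]

/-- The product of a function and a form. -/
noncomputable def formMul (r : Ω → ℂ) (α : FormField n Ω E) : FormField n Ω E :=
  fun x => r x • α x

theorem chartCoeff_formMul (e : OpenPartialHomeomorph Ω (Fin n → ℂ)) (r : Ω → ℂ)
    (α : FormField n Ω E) (z : Fin n → ℂ) :
    chartCoeff e (formMul r α) z = r (e.symm z) • chartCoeff e α z := rfl

theorem IsAnalyticForm.formMul {r : Ω → ℂ} (hr : ContMDiff 𝓘(ℂ, Fin n → ℂ) 𝓘(ℂ, ℂ) ω r)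
    {α : FormField n Ω E} (hα : IsAnalyticForm α) : IsAnalyticForm (formMul r α) := fun e he =>
  (analyticOnNhd_comp_symm hr he).smul (hα e he)

variable [MeasurableSpace Ω] [BorelSpace Ω]

/-- `formMeasure_le` compares with a sum of two measures; here the second form is 0. -/
theorem weightedNormSq_formMul_le (S : ConjInvolution E) (k : Ω → ℝ) {r : Ω → ℂ} {C : ℝ≥0}
    (hC : ∀ x, ‖r x‖ ≤ C) {α : FormField n Ω E} (hα : IsAnalyticForm α) :
    weightedNormSq S k (formMul r α) ≤ (C ^ 2 : ℝ≥0) * weightedNormSq S k α := by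
  have h := formMeasure_le S (γ := formMul r α) (β := (0 : FormField n Ω E)) hα (C ^ 2)
    fun e z => by
      have h0 : chartCoeff e (0 : FormField n Ω E) z = 0 := rfl
      rw [chartCoeff_formMul, h0, norm_zero, norm_smul, mul_pow]
      have := hC (e.symm z)
      push_cast
      rw [zero_pow two_ne_zero, add_zero]
      gcongr
  have h0 : formMeasure S (0 : FormField n Ω E) = 0 := by
    have hz : ∀ (e : OpenPartialHomeomorph Ω (Fin n → ℂ)) z,
        ENNReal.ofReal (S.density (inChart e (0 : FormField n Ω E) z)).re = 0 := fun e z => by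
      rw [ofReal_density_inChart]
      have h0 : chartCoeff e (0 : FormField n Ω E) z = 0 := rfl
      simp [h0]
    refine le_antisymm (iSup₂_le fun e _ => ?_) (Measure.zero_le _)
    simp [chartMeasure, hz]
  rw [h0, add_zero] at h
  refine (lintegral_mono' h le_rfl).trans ?_
  rw [lintegral_smul_measure]
  rfl

theorem formMul_mem_bergmanSpace (S : ConjInvolution E) {k : Ω → ℝ} {r : Ω → ℂ}
    (hr : r ∈ boundedAnalytic n Ω) {α : FormField n Ω E} (hα : α ∈ bergmanSpace (n := n) S k) :
    formMul r α ∈ bergmanSpace (n := n) S k := by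
  obtain ⟨hr, C, hC⟩ := hr
  refine ⟨hα.1.formMul hr, (weightedNormSq_formMul_le S k (C := C.toNNReal)
    (fun x => (hC x).trans (Real.le_coe_toNNReal C)) hα.1).trans_lt ?_⟩
  exact ENNReal.mul_lt_top ENNReal.coe_lt_top hα.2

/-- The pointwise module structure of a weighted Bergman space. -/
@[reducible]
noncomputable def bergmanModule (S : ConjInvolution E) (k : Ω → ℝ) {R : Subalgebra ℂ (Ω → ℂ)}
    (hR : R ≤ boundedAnalytic n Ω) : Module R (bergmanSpace (n := n) (E := E) S k) where
  smul r α := ⟨formMul (r : Ω → ℂ) α, formMul_mem_bergmanSpace S (hR r.2) α.2⟩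
  one_smul _ := Subtype.ext (funext fun _ => one_smul _ _)
  mul_smul _ _ _ := Subtype.ext (funext fun _ => mul_smul _ _ _)
  smul_zero _ := Subtype.ext (funext fun _ => smul_zero _)
  smul_add _ _ _ := Subtype.ext (funext fun _ => smul_add _ _ _)
  add_smul _ _ _ := Subtype.ext (funext fun _ => add_smul _ _ _)
  zero_smul _ := Subtype.ext (funext fun _ => zero_smul _ _)

end PointwiseMultiplication

/-! ### The valuation on functions -/

section FunctionOrder

variable {n : ℕ} {Ω : Type*} [TopologicalSpace Ω] [ChartedSpace (Fin n → ℂ) Ω]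

theorem one_le_functionOrder_iff {p : Ω} {r : Ω → ℂ} :
    1 ≤ functionOrder (n := n) p r ↔ r p = 0 := by
  rw [functionOrder, one_le_orderOfZero_iff, Function.comp_apply,
    (chartAt (Fin n → ℂ) p).left_inv (mem_chart_source _ p)]

variable [IsManifold 𝓘(ℂ, Fin n → ℂ) ω Ω]

theorem analyticAt_comp_chartAt_symm {r : Ω → ℂ}
    (hr : ContMDiff 𝓘(ℂ, Fin n → ℂ) 𝓘(ℂ, ℂ) ω r) (p : Ω) :
    AnalyticAt ℂ (r ∘ (chartAt (Fin n → ℂ) p).symm) (chartAt (Fin n → ℂ) p p) :=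
  analyticOnNhd_comp_symm hr (IsManifold.chart_mem_maximalAtlas p) _ (mem_chart_target _ p)

theorem isAlgebraValuation_functionOrder [PreconnectedSpace Ω] {R : Subalgebra ℂ (Ω → ℂ)}
    (hR : ∀ r ∈ R, ContMDiff 𝓘(ℂ, Fin n → ℂ) 𝓘(ℂ, ℂ) ω r) (p : Ω) :
    IsAlgebraValuation fun r : R => functionOrder (n := n) p (r : Ω → ℂ) where
  ord_unit r hr := by
    by_contra h
    have h0 := one_le_functionOrder_iff.1 (Order.one_le_iff_ne_zero.2 h)
    rcases hr with ⟨s, hs⟩ | ⟨s, hs⟩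
    · have := congrArg (fun t : R => (t : Ω → ℂ) p) hs
      simp [h0] at this
    · have := congrArg (fun t : R => (t : Ω → ℂ) p) hs
      simp [h0] at this
  ord_eq_top_iff r := by
    rw [functionOrder_eq_top_iff (hR r r.2)]
    exact ⟨fun h => Subtype.ext h, fun h => by rw [h]; rfl⟩
  ord_mul r s := orderOfZero_smul_le (analyticAt_comp_chartAt_symm (hR r r.2) p)
    (analyticAt_comp_chartAt_symm (hR s s.2) p)
  ord_smul c r hc := orderOfZero_const_smul (analyticAt_comp_chartAt_symm (hR r r.2) p) hc
  ord_add r s := orderOfZero_add_le (analyticAt_comp_chartAt_symm (hR r r.2) p)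
    (analyticAt_comp_chartAt_symm (hR s s.2) p)

end FunctionOrder

/-! ### The valuation Hilbert module -/

section HilbertModule

variable {n : ℕ} {Ω : Type*} [TopologicalSpace Ω] [ChartedSpace (Fin n → ℂ) Ω]
  [MeasurableSpace Ω] [BorelSpace Ω]
  {E : Type*} [NormedAddCommGroup E] [InnerProductSpace ℂ E]
  {R : Subalgebra ℂ (Ω → ℂ)} {H : Type*} [NormedAddCommGroup H] [InnerProductSpace ℂ H]
  [Module R H] {ι : H →ₗ[ℂ] FormField n Ω E} {S : ConjInvolution E} {k : Ω → ℝ}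

/-- Here and below H is an abstract space mapped to forms by ι, so that the norm and the module
structure to be constructed on the Bergman space enter only through `hnorm` and `hmul`. -/
theorem isHilbertModule_of_bergman [CompleteSpace H] (hR : R ≤ boundedAnalytic n Ω)
    (hinj : Function.Injective ι) (hmem : ∀ h, ι h ∈ bergmanSpace (n := n) S k)
    (hnorm : ∀ h, ‖h‖ = √(weightedNormSq S k (ι h)).toReal)
    (hmul : ∀ (r : R) (h : H), ι (r • h) = formMul (r : Ω → ℂ) (ι h)) :
    IsHilbertModule R H where
  complete := inferInstance
  smul_assoc c r h := hinj <| by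
    rw [hmul, map_smul, hmul]
    exact funext fun x => smul_assoc c _ _
  continuous_smul r := by
    obtain ⟨-, C, hC⟩ := hR r.2
    refine AddMonoidHomClass.continuous_of_bound (DistribSMul.toAddMonoidHom H r) C.toNNReal
      fun h => ?_
    have h1 := weightedNormSq_formMul_le S k (C := C.toNNReal)
      (fun x => (hC x).trans (Real.le_coe_toNNReal C)) (hmem h).1
    have h2 := ENNReal.toReal_mono (ENNReal.mul_ne_top ENNReal.coe_ne_top (hmem h).2.ne) h1
    rw [ENNReal.toReal_mul, ENNReal.coe_toReal, NNReal.coe_pow] at h2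
    change ‖r • h‖ ≤ _
    rw [hnorm, hnorm, hmul]
    refine (Real.sqrt_le_sqrt h2).trans (le_of_eq ?_)
    rw [Real.sqrt_mul (by positivity), Real.sqrt_sq (NNReal.coe_nonneg _)]

variable [CompleteSpace E]

/-- The map is additive and, by Cauchy's estimates, bounded. This is the source of the upper
semicontinuity of the order. -/
theorem continuous_iteratedFDeriv_chartCoeff (hk : IsAdmissibleWeight n k)
    (hmem : ∀ h, ι h ∈ bergmanSpace (n := n) S k)
    (hnorm : ∀ h, ‖h‖ = √(weightedNormSq S k (ι h)).toReal)
    {e : OpenPartialHomeomorph Ω (Fin n → ℂ)}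
    (he : e ∈ IsManifold.maximalAtlas 𝓘(ℂ, Fin n → ℂ) ω Ω) {z : Fin n → ℂ} (hz : z ∈ e.target)
    (m : ℕ) : Continuous fun h : H => iteratedFDeriv ℂ m (chartCoeff e (ι h)) z := by
  obtain ⟨C, -, hC⟩ := exists_norm_iteratedFDeriv_chartCoeff_le S hk he hz m
  let L := AddMonoidHom.mk' (fun h : H => iteratedFDeriv ℂ m (chartCoeff e (ι h)) z)
    fun a b => by
      rw [map_add, chartCoeff_add]
      exact iteratedFDeriv_add_apply ((hmem a).1 e he z hz).contDiffAt
        ((hmem b).1 e he z hz).contDiffAt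
  refine AddMonoidHomClass.continuous_of_bound L C fun h => ?_
  rw [hnorm]
  exact hC _ (hmem h)

theorem isAnalyticHilbertModuleOfForms_of_bergman [CompleteSpace H]
    (hR : R ≤ boundedAnalytic n Ω) (hk : IsAdmissibleWeight n k)
    (hinj : Function.Injective ι) (hmem : ∀ h, ι h ∈ bergmanSpace (n := n) S k)
    (hnorm : ∀ h, ‖h‖ = √(weightedNormSq S k (ι h)).toReal)
    (hmul : ∀ (r : R) (h : H), ι (r • h) = formMul (r : Ω → ℂ) (ι h)) :
    IsAnalyticHilbertModuleOfForms R ι where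
  analytic_algebra r hr := (hR hr).1
  injective := hinj
  analytic_form h := (hmem h).1
  hilbertModule := isHilbertModule_of_bergman hR hinj hmem hnorm hmul
  pointwise r h x := by rw [hmul]; rfl
  uniform_on_compacts h h₀ hh e he K hKe hK := by
    obtain ⟨C, hC, hb⟩ := exists_norm_chartCoeff_le_of_isCompact S hk he hKe hK
    refine Metric.tendstoUniformlyOn_iff.2 fun ε hε => ?_
    filter_upwards [Metric.tendsto_nhds.1 hh (ε / C) (by positivity)] with j hj z hz
    have h1 := hb _ (hmem (h₀ - h j)) z hz
    rw [← hnorm, ← dist_eq_norm, dist_comm, map_sub] at h1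
    rw [lt_div_iff₀ hC, mul_comm] at hj
    rw [dist_eq_norm]
    exact h1.trans_lt hj

variable [IsManifold 𝓘(ℂ, Fin n → ℂ) ω Ω]

theorem isHilbertModuleValuation_formOrder [PreconnectedSpace Ω]
    (hR : R ≤ boundedAnalytic n Ω) (hk : IsAdmissibleWeight n k)
    (hinj : Function.Injective ι) (hmem : ∀ h, ι h ∈ bergmanSpace (n := n) S k)
    (hnorm : ∀ h, ‖h‖ = √(weightedNormSq S k (ι h)).toReal)
    (hmul : ∀ (r : R) (h : H), ι (r • h) = formMul (r : Ω → ℂ) (ι h)) (p : Ω) :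
    IsHilbertModuleValuation (fun r : R => functionOrder (n := n) p (r : Ω → ℂ))
      (fun h : H => formOrder p (ι h)) := by
  have he := IsManifold.chart_mem_maximalAtlas (I := 𝓘(ℂ, Fin n → ℂ)) (n := ω) p
  have hz := mem_chart_target (Fin n → ℂ) p
  have han : ∀ h, AnalyticAt ℂ (chartCoeff (chartAt (Fin n → ℂ) p) (ι h))
      (chartAt (Fin n → ℂ) p p) := fun h => (hmem h).1 _ he _ hz
  refine ⟨fun h => ?_, fun r h => ?_, fun c h hc => ?_, fun a b => ?_, fun h y hy => ?_⟩
  · rw [formOrder_eq_top_iff (hmem h).1, map_eq_zero_iff ι hinj]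
  · rw [hmul]
    exact orderOfZero_smul_le (analyticAt_comp_chartAt_symm (hR r.2).1 p) (han h)
  · rw [map_smul]
    exact orderOfZero_const_smul (han h) hc
  · rw [map_add]
    exact orderOfZero_add_le (han a) (han b)
  -- If h has order m, some derivative of order j ≤ m is nonzero at p. It stays nonzero for all g
  -- near h, so ord g ≤ m.
  · obtain ⟨m, hm⟩ := ENat.ne_top_iff_exists.1 (ne_top_of_lt hy)
    have h1 : ¬ ((m + 1 : ℕ) : ℕ∞) ≤ formOrder p (ι h) := by
      rw [← hm]
      exact_mod_cast m.lt_succ_self.not_ge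
    rw [formOrder, le_orderOfZero_iff] at h1
    push Not at h1
    obtain ⟨j, hj, hne⟩ := h1
    filter_upwards [(continuous_iteratedFDeriv_chartCoeff hk hmem hnorm he hz
      j).continuousAt.eventually_ne hne] with g hg
    refine lt_of_le_of_lt (le_trans (iInf₂_le j hg) (le_trans ?_ hm.le)) hy
    exact_mod_cast Nat.lt_succ_iff.1 hj

theorem exists_beurling_of_bergman [PreconnectedSpace Ω] [CompleteSpace H]
    (hR : R ≤ boundedAnalytic n Ω) (hk : IsAdmissibleWeight n k)
    (hinj : Function.Injective ι) (hmem : ∀ h, ι h ∈ bergmanSpace (n := n) S k)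
    (hnorm : ∀ h, ‖h‖ = √(weightedNormSq S k (ι h)).toReal)
    (hmul : ∀ (r : R) (h : H), ι (r • h) = formMul (r : Ω → ℂ) (ι h)) (p : Ω) :
    ∃ hv : IsValuationHilbertModule (fun r : R => functionOrder (n := n) p (r : Ω → ℂ))
      (fun h : H => formOrder p (ι h)), hv.BeurlingCharacterization := by
  refine ⟨⟨isAlgebraValuation_functionOrder (fun r hr => (hR hr).1) p,
    isHilbertModule_of_bergman hR hinj hmem hnorm hmul,
    isHilbertModuleValuation_formOrder hR hk hinj hmem hnorm hmul p⟩,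
    IsValuationHilbertModule.beurlingCharacterization _ fun r => ⟨(r : Ω → ℂ) p, ?_⟩⟩
  -- The constant to be split off from r is its value at p.
  rw [one_le_functionOrder_iff]
  simp [Algebra.algebraMap_eq_smul_one]

end HilbertModule

/-! ### Transport of the inner product and conclusion -/

section Core

variable {V W : Type*} [AddCommGroup V] [Module ℂ V] [NormedAddCommGroup W]
  [InnerProductSpace ℂ W]

/-- The inner product induced by an injective linear map into an inner product space. -/
@[reducible]
noncomputable def coreOfInjective (T : V →ₗ[ℂ] W) (hT : Function.Injective T) : InnerProductSpace.Core ℂ V where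
  inner x y := inner ℂ (T x) (T y)
  conj_inner_symm x y := inner_conj_symm (T x) (T y)
  re_inner_nonneg x := inner_self_nonneg
  add_left x y z := by rw [map_add, inner_add_left]
  smul_left x y c := by rw [map_smul, inner_smul_left]
  definite x hx := hT (by rw [inner_self_eq_zero.1 hx, map_zero])

theorem completeSpace_of_isClosed_range {H : Type*} [NormedAddCommGroup H]
    [InnerProductSpace ℂ H] [CompleteSpace W] (T : H →ₗ[ℂ] W) (hT : ∀ x, ‖T x‖ = ‖x‖)
    (hcl : IsClosed (range T)) : CompleteSpace H :=
  (AddMonoidHomClass.isometry_of_norm T hT).isUniformInducing.completeSpace hcl.isComplete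

end Core

/-- The weighted Bergman space over any algebra of bounded analytic functions. -/
theorem bergmanSpaceIsBeurlingModule_of_le {n : ℕ} {Ω : Type*} [TopologicalSpace Ω] [T2Space Ω]
    [ParacompactSpace Ω] [ConnectedSpace Ω] [ChartedSpace (Fin n → ℂ) Ω]
    [IsManifold 𝓘(ℂ, Fin n → ℂ) ω Ω] [MeasurableSpace Ω] [BorelSpace Ω]
    {E : Type*} [NormedAddCommGroup E] [InnerProductSpace ℂ E] [CompleteSpace E]
    (S : ConjInvolution E) (p : Ω) {k : Ω → ℝ} (hk : IsAdmissibleWeight n k)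
    {R : Subalgebra ℂ (Ω → ℂ)} (hR : R ≤ boundedAnalytic n Ω) :
    BergmanSpaceIsBeurlingModule (n := n) S k p R := by
  obtain ⟨P⟩ := ChartPartition.nonempty n Ω
  -- The inner product is pulled back from L². It does not depend on the partition P, since its norm
  -- is given by `weightedNormSq`.
  let c := coreOfInjective (P.toL2 S hk) (P.toL2_injective S hk)
  refine ⟨c, bergmanModule S k hR, ?_⟩
  let : NormedAddCommGroup (bergmanSpace (n := n) S k) := c.toNormedAddCommGroup
  let : InnerProductSpace ℂ (bergmanSpace (n := n) S k) := .ofCore c.toCore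
  let := bergmanModule S k hR
  have hT : ∀ α : bergmanSpace (n := n) S k, ‖α‖ = ‖P.toL2 S hk α‖ := fun α => by
    rw [norm_eq_sqrt_re_inner (𝕜 := ℂ) α, norm_eq_sqrt_re_inner (𝕜 := ℂ) (P.toL2 S hk α)]
    rfl
  have hnorm : ∀ α : bergmanSpace (n := n) S k,
      ‖α‖ = √(weightedNormSq S k ((bergmanSpace (n := n) S k).subtype α)).toReal := fun α => by
    rw [hT, ← P.sqrt_weightedNormSq S hk]
    rfl
  have := completeSpace_of_isClosed_range (P.toL2 S hk) (fun α => (hT α).symm)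
    (P.isClosed_range_toL2 S hk)
  have hinj : Function.Injective (bergmanSpace (n := n) (E := E) S k).subtype :=
    Subtype.val_injective
  have hmem : ∀ α, (bergmanSpace (n := n) (E := E) S k).subtype α ∈ bergmanSpace (n := n) S k :=
    fun α => α.2
  refine ⟨fun α => by rw [hT, P.norm_toL2_sq S hk],
    isAnalyticHilbertModuleOfForms_of_bergman hR hk hinj hmem hnorm fun _ _ => rfl,
    exists_beurling_of_bergman hR hk hinj hmem hnorm (fun _ _ => rfl) p⟩

/-- The polynomials are generated by the coordinate functions, which are analytic, and bounded on a
bounded set. -/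
theorem polynomialAlgebraOn_le_boundedAnalytic {n : ℕ} {U : TopologicalSpace.Opens (Fin n → ℂ)}
    (hU : Bornology.IsBounded (U : Set (Fin n → ℂ))) :
    polynomialAlgebraOn U ≤ boundedAnalytic n U := by
  rw [polynomialAlgebraOn, ← Algebra.map_top, ← MvPolynomial.adjoin_range_X, AlgHom.map_adjoin,
    Algebra.adjoin_le_iff]
  rintro - ⟨-, ⟨i, rfl⟩, rfl⟩
  obtain ⟨C, hC⟩ := hU.exists_norm_le
  simp only [MvPolynomial.aeval_X]
  refine ⟨?_, C, fun z => (norm_le_pi_norm (z : Fin n → ℂ) i).trans (hC z z.2)⟩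
  have h1 : ContMDiff 𝓘(ℂ, Fin n → ℂ) 𝓘(ℂ, Fin n → ℂ) ω (Subtype.val : U → Fin n → ℂ) :=
    contMDiff_subtype_val
  have h2 : ContMDiff 𝓘(ℂ, Fin n → ℂ) 𝓘(ℂ, ℂ) ω fun z : Fin n → ℂ => z i :=
    (contDiff_apply ℂ ℂ i).contMDiff
  exact h2.comp h1

theorem theorem7p5 (n : ℕ) (hn : 1 ≤ n)
    {E : Type*} [NormedAddCommGroup E] [InnerProductSpace ℂ E] [CompleteSpace E]
    (S : ConjInvolution E) :
    (∀ (Ω : Type*) [TopologicalSpace Ω] [T2Space Ω] [ParacompactSpace Ω] [ConnectedSpace Ω]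
        [ChartedSpace (Fin n → ℂ) Ω] [IsManifold 𝓘(ℂ, Fin n → ℂ) ω Ω]
        [MeasurableSpace Ω] [BorelSpace Ω] (p : Ω) (k : Ω → ℝ),
      IsAdmissibleWeight n k →
        BergmanSpaceIsBeurlingModule (n := n) S k p (boundedAnalytic n Ω)) ∧
    (∀ (Ω : TopologicalSpace.Opens (Fin n → ℂ)), IsConnected (Ω : Set (Fin n → ℂ)) →
      Bornology.IsBounded (Ω : Set (Fin n → ℂ)) → ∀ (p : Ω) (k : Ω → ℝ),
      IsAdmissibleWeight n k →
        BergmanSpaceIsBeurlingModule (n := n) S k p (polynomialAlgebraOn Ω)) := by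
  -- The case of H^∞ on a bounded domain is contained in the first clause, so only polynomials need
  -- a separate one.
  refine ⟨fun Ω _ _ _ _ _ _ _ _ p k hk => bergmanSpaceIsBeurlingModule_of_le S p hk le_rfl,
    fun Ω hc hb p k hk => ?_⟩
  have : ConnectedSpace Ω := isConnected_iff_connectedSpace.1 hc
  exact bergmanSpaceIsBeurlingModule_of_le S p hk (polynomialAlgebraOn_le_boundedAnalytic hb)
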